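/- Let $C=\operatorname{Spec}A$ be a connected nonsingular affine algebraic curve over $\mathbb C$ (and also denote by $C$ the underlying Riemann surface), $\overline C\supset C$ its smooth compactification, $S=\overline C\smallsetminus C$ (a finite set), $p:\tilde C\to C$ a universal cover, $\Gamma_C=\mathrm{Aut}(\tilde C/C)$, and $\mathcal O_{hol}(\tilde C)$ the algebra of holomorphic functions on $\tilde C$. Let $D=\{|z|\le 1\}$, $D^\times=D\smallsetminus\{0\}$, $\tilde D^\times=\{u\in\mathbb C:\operatorname{Im}u\ge 0\}$, $e(u)=e^{2\pi i u}$, $\log z:=2\pi i u$ on $\tilde D^\times$; for $F=D,D^\times,\tilde D^\times$ let $\mathcal O_{hol}(F)$ be the continuous functions on $F$ holomorphic in the interior of $F$ (maps from $F$ to Riemann surfaces are called holomorphic in the same sense). Let $\mathcal O(D^\times)$ be the set of $g\in\mathcal O_{hol}(D^\times)$ such that $z^ng$ extends to an element of $\mathcal O_{hol}(D)$ for some $n\ge0$, and let $\mathcal O_{mod}(\tilde D^\times)$ be the set of $f\in\mathcal O_{hol}(\tilde D^\times)$ for which there are an integer $n>0$ and constants $C_{a,b}\ge0$ $(a\le b)$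 with $|f(x+iy)|\le C_{a,b}e^{2\pi n y}$ for all $x\in[a,b]$, $y\ge0$. For each $s\in S$ choose an injective holomorphic map $\varphi_s:D\to\overline C$ with $\varphi_s(0)=s$ and $\varphi_s(D)\cap S=\{s\}$; let $X_s$ be the set of connected components of $p^{-1}(\varphi_s(D^\times))$, and for each $x\in X_s$ choose a holomorphic map $\tilde\varphi_{s,x}:\tilde D^\times\to\tilde C$ with image in the component $x$ and $p\circ\tilde\varphi_{s,x}=\varphi_s\circ e$. Let $\mathcal O_{mod}(\tilde C)$ be the set of $f\in\mathcal O_{hol}(\tilde C)$ with $f\circ\tilde\varphi_{s,x}\in\mathcal O_{mod}(\tilde D^\times)$ for all $s\in S,x\in X_s$. With $f_{|\gamma}=f\circ\gamma$, let $F_n\mathcal O_{mod}(\tilde C)$ be the set of $f\in\mathcal O_{mod}(\tilde C)$ with $f_{|(\gamma_1-1)\cdots(\gamma_{n+1}-1)}=0$ for all $\gamma_1,\dots,\gamma_{n+1}\in\Gamma_C$, and $F_\infty\mathcal O_{mod}(\tilde C)=\bigcup_{n\ge0}F_n\mathcal O_{mod}(\tilde C)$. Let $A_C$ be the intersection of all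 unital subalgebras $B\subset\mathcal O_{hol}(\tilde C)$ such that $z\mapsto\int_{z_0}^z f\,p^*\omega$ lies in $B$ for all $f\in B$, all regular differentials $\omega$ on $C$ and all $z_0\in\tilde C$. A function $f\in \mathcal O_{hol}(\tilde C)$ is of Nilsson class if it is of finite determination (the functions $f\circ\gamma$, $\gamma\in\Gamma_C$, span a finite-dimensional space) and of moderate growth ($f\in\mathcal O_{mod}(\tilde C)$). Then: (1) For every $f\in F_\infty\mathcal O_{mod}(\tilde C)$, every $s\in S$ and every $x\in X_s$, the pull-back $f\circ\tilde\varphi_{s,x}$ lies in $\mathcal O(D^\times)[\log z]$, that is, $f(\tilde\varphi_{s,x}(u))=\sum_{k<N} g_k(e(u))(2\pi i u)^k$ on $\tilde D^\times$ with $g_k\in\mathcal O(D^\times)$; equivalently it has the form $z^{\alpha}P(\log z)$ with $\alpha\in\mathbb Z$ and $P$ a polynomial with coefficients in $\mathcal O_{hol}(D)$ (both forms are asserted). (2) In particular every $f\in A_C$ is a function of Nilsson class, of the following special kind: for all $s\in S$, $x\in X_s$, $f\circ\tilde\varphi_{s,x}$ lies in $\mathcal O(D^\times)[\log z]$ and has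 the form $z^{\alpha}P(\log z)$ with a single exponent $\alpha\in\mathbb Z$ and $P$ a polynomial with coefficients in $\mathcal O_{hol}(D)$. -/

import Mathlib

open scoped Manifold ContDiff

noncomputable section

namespace NilssonCurve

/-! ## Functions on the closed disc, the punctured disc and its universal cover

The disc, its punctured version and the half-plane contain their boundary.  As usual, a function
on such a set is called holomorphic if it is continuous on the set and holomorphic on the
interior. -/

/-- The closed unit disc `D`. -/
def disc : Set ℂ := Metric.closedBall 0 1

/-- The punctured closed disc `D^×`. -/
def puncturedDisc : Set ℂ := disc \ {0}

/-- The closed upper half-plane, the universal cover of `D^×` via `expMap`. -/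
def halfPlane : Set ℂ := {u | 0 ≤ u.im}

/-- The covering map `e(u) = exp(2πiu)`. -/
def expMap (u : ℂ) : ℂ := Complex.exp (2 * Real.pi * Complex.I * u)

/-- The function `log z` on the half-plane, i.e. `u ↦ 2πiu`. -/
def logFun (u : ℂ) : ℂ := 2 * Real.pi * Complex.I * u

/-- `f` (restricted to `F`) belongs to `O_hol(F)`, for `F` one of `D`, `D^×`, the half-plane. -/
def HolOn (F : Set ℂ) (f : ℂ → ℂ) : Prop :=
  ContinuousOn f F ∧ DifferentiableOn ℂ f (interior F)

/-- Same notion for maps from `F` to a Riemann surface. -/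
def HolMapOn {M : Type*} [TopologicalSpace M] [ChartedSpace ℂ M] (F : Set ℂ) (f : ℂ → M) : Prop :=
  ContinuousOn f F ∧ MDifferentiableOn 𝓘(ℂ) 𝓘(ℂ) f (interior F)

/-- `O(D^×)`: functions `g` holomorphic on `D^×` such that `z^n g` extends to a holomorphic function
on `D` for some `n ≥ 0`. -/
def MeroAtZero (g : ℂ → ℂ) : Prop :=
  HolOn puncturedDisc g ∧ ∃ n : ℕ, ∃ h : ℂ → ℂ, HolOn disc h ∧ ∀ z ∈ puncturedDisc, h z = z ^ n * g z

/-- Moderate growth functions on the half-plane. -/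
def ModerateOnHalfPlane (f : ℂ → ℂ) : Prop :=
  HolOn halfPlane f ∧
    ∃ n : ℕ, 0 < n ∧ ∃ K : ℝ → ℝ → ℝ, ∀ a b : ℝ, a ≤ b → 0 ≤ K a b ∧
      ∀ x y : ℝ, x ∈ Set.Icc a b → 0 ≤ y →
        ‖f (x + y * Complex.I)‖ ≤ K a b * Real.exp (2 * Real.pi * n * y)

/-- `F` (restricted to the half-plane) belongs to `O(D^×)[log z]`: it is a polynomial in `log z` with
coefficients the pull-backs by `e` of elements of `O(D^×)`. -/
def IsLogPolynomial (F : ℂ → ℂ) : Prop :=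
  ∃ N : ℕ, ∃ g : ℕ → ℂ → ℂ, (∀ k, MeroAtZero (g k)) ∧
    ∀ u ∈ halfPlane, F u = ∑ k ∈ Finset.range N, g k (expMap u) * logFun u ^ k

/-- `F = z^α P(log z)` on the half-plane, with a single exponent `α ∈ ℤ` and `P` a polynomial whose
coefficients are holomorphic on `D`. -/
def HasIntegralNilssonExpansion (F : ℂ → ℂ) : Prop :=
  ∃ α : ℤ, ∃ N : ℕ, ∃ h : ℕ → ℂ → ℂ, (∀ k, HolOn disc (h k)) ∧
    ∀ u ∈ halfPlane,
      F u = expMap u ^ α * ∑ k ∈ Finset.range N, h k (expMap u) * logFun u ^ k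

/-! ## The curve, its compactification, its universal cover -/

/-- The Riemann surface `C` is the analytic space of the complex points of `Spec A`: its points are
the `ℂ`-algebra morphisms `A → ℂ`, its topology is the classical one (the coarsest for which the
regular functions are continuous), and regular functions are holomorphic.

For `A` smooth of dimension one this determines the complex structure: by the last condition the
identity from `C` to the analytification is a holomorphic bijection of Riemann surfaces, hence
biholomorphic. -/
structure Analytification (A C : Type*) [CommRing A] [Algebra ℂ A]
    [TopologicalSpace C] [ChartedSpace ℂ C] where
  /-- The point of `Spec A` underlying an element of `C`. -/
  pt : C → (A →ₐ[ℂ] ℂ)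
  bijective : Function.Bijective pt
  isInducing : Topology.IsInducing (fun (c : C) (a : A) => pt c a)
  mdifferentiable : ∀ a : A, MDifferentiable 𝓘(ℂ) 𝓘(ℂ) (fun c => pt c a)

/-- `Cbar` (which will be a compact connected Riemann surface) is the smooth compactification of `C`:
`C` is, through `ι`, the complement of a finite subset. -/
structure Compactification (C Cbar : Type*) [TopologicalSpace C] [ChartedSpace ℂ C]
    [TopologicalSpace Cbar] [ChartedSpace ℂ Cbar] where
  /-- The inclusion. -/
  ι : C → Cbar
  isOpenEmbedding : Topology.IsOpenEmbedding ι
  mdifferentiable : MDifferentiable 𝓘(ℂ) 𝓘(ℂ) ι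
  finite_compl : (Set.range ι)ᶜ.Finite

/-- The set of punctures `S`, the complement of `C` in `Cbar`. -/
def Compactification.punctures {C Cbar : Type*} [TopologicalSpace C] [ChartedSpace ℂ C]
    [TopologicalSpace Cbar] [ChartedSpace ℂ Cbar] (K : Compactification C Cbar) : Set Cbar :=
  (Set.range K.ι)ᶜ

/-- A universal cover of the Riemann surface `C`. -/
structure UniversalCover (C Ct : Type*) [TopologicalSpace C] [ChartedSpace ℂ C]
    [TopologicalSpace Ct] [ChartedSpace ℂ Ct] where
  /-- The covering map. -/
  p : Ct → C
  surjective : Function.Surjective p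
  isCoveringMap : IsCoveringMap p
  mdifferentiable : MDifferentiable 𝓘(ℂ) 𝓘(ℂ) p
  simplyConnected : SimplyConnectedSpace Ct

section Cover

variable {C Ct : Type*} [TopologicalSpace C] [ChartedSpace ℂ C]
  [TopologicalSpace Ct] [ChartedSpace ℂ Ct]

/-- The group `Γ_C = Aut(Ct / C)` of deck transformations. -/
def UniversalCover.deckGroup (U : UniversalCover C Ct) : Subgroup (Ct ≃ₜ Ct) where
  carrier := {γ | ∀ z, U.p (γ z) = U.p z}
  mul_mem' := by
    intro a b ha hb z
    exact (ha (b z)).trans (hb z)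
  one_mem' := fun _ => rfl
  inv_mem' := by
    intro a ha z
    have h := ha (a⁻¹ z)
    rw [← h]
    exact congrArg U.p (a.apply_symm_apply z)

variable (Ct) in
/-- The algebra `O_hol(Ct)` of holomorphic functions. -/
def holFun : Subalgebra ℂ (Ct → ℂ) where
  carrier := {f | MDifferentiable 𝓘(ℂ) 𝓘(ℂ) f}
  mul_mem' := fun ha hb => MDifferentiable.mul ha hb
  add_mem' := fun ha hb => MDifferentiable.add ha hb
  algebraMap_mem' := fun _ => mdifferentiable_const

/-- The action of `γ - 1` on functions: `f ↦ f ∘ γ - f`. -/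
def diffOp (γ : Ct ≃ₜ Ct) (f : Ct → ℂ) : Ct → ℂ := fun z => f (γ z) - f z

/-- `f` is of finite determination: its branches `f ∘ γ`, for `γ ∈ Γ_C`, span a finite-dimensional
space. -/
def FiniteDetermination (U : UniversalCover C Ct) (f : Ct → ℂ) : Prop :=
  (Submodule.span ℂ (Set.range fun γ : U.deckGroup => f ∘ (γ : Ct ≃ₜ Ct))).FG

end Cover

/-! ## Local data at the punctures and moderate growth functions -/

section Punctures

variable {C Cbar Ct : Type*} [TopologicalSpace C] [ChartedSpace ℂ C]
  [TopologicalSpace Cbar] [ChartedSpace ℂ Cbar] [TopologicalSpace Ct] [ChartedSpace ℂ Ct]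

/-- A choice, for each puncture `s`, of a closed disc in `Cbar` centered at `s` and containing no
other puncture. -/
structure PunctureDiscs (K : Compactification C Cbar) where
  /-- The parametrization `φ_s` of the disc, relevant on `disc` only. -/
  φ : K.punctures → ℂ → Cbar
  hol : ∀ s, HolMapOn disc (φ s)
  injOn : ∀ s, Set.InjOn (φ s) disc
  map_zero : ∀ s, φ s 0 = s
  inter : ∀ s, φ s '' disc ∩ K.punctures = {(s : Cbar)}

/-- The preimage in `Ct` of the punctured disc `U_s^× = φ_s(D^×)`. -/
def PunctureDiscs.preimage {K : Compactification C Cbar} (φ : PunctureDiscs K)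
    (U : UniversalCover C Ct) (s : K.punctures) : Set Ct :=
  {z | K.ι (U.p z) ∈ φ.φ s '' puncturedDisc}

/-- The set `X_s` of connected components of the preimage of `U_s^×`. -/
def PunctureDiscs.lifts {K : Compactification C Cbar} (φ : PunctureDiscs K)
    (U : UniversalCover C Ct) (s : K.punctures) : Type _ :=
  ConnectedComponents (φ.preimage U s)

/-- A choice, for each puncture `s` and each `x ∈ X_s`, of a holomorphic map from the half-plane
to the component `x`, lifting `φ_s ∘ e`. -/
structure LiftedDiscs {K : Compactification C Cbar} (φ : PunctureDiscs K)
    (U : UniversalCover C Ct) where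
  /-- The lift, relevant on `halfPlane` only. -/
  φt : (s : K.punctures) → φ.lifts U s → ℂ → Ct
  hol : ∀ s x, HolMapOn halfPlane (φt s x)
  lift : ∀ s x, ∀ u ∈ halfPlane, K.ι (U.p (φt s x u)) = φ.φ s (expMap u)
  mem_component : ∀ s x, ∀ u ∈ halfPlane,
    ∃ h : φt s x u ∈ φ.preimage U s, (ConnectedComponents.mk ⟨φt s x u, h⟩ : φ.lifts U s) = x

variable {K : Compactification C Cbar} {φ : PunctureDiscs K} {U : UniversalCover C Ct}

/-- `O_mod(Ct)`, the holomorphic functions on `Ct` of moderate growth at all punctures. -/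
def moderateFun (L : LiftedDiscs φ U) : Set (Ct → ℂ) :=
  {f | f ∈ holFun Ct ∧ ∀ s x, ModerateOnHalfPlane (f ∘ L.φt s x)}

/-- `F_n O_mod(Ct)`: the elements of `O_mod(Ct)` killed by all products
`(γ_1 - 1) ⋯ (γ_{n+1} - 1)` with `γ_i ∈ Γ_C`. -/
def moderateFiltration (L : LiftedDiscs φ U) (n : ℕ) : Set (Ct → ℂ) :=
  {f | f ∈ moderateFun L ∧ ∀ l : List (Ct ≃ₜ Ct), l.length = n + 1 → (∀ γ ∈ l, γ ∈ U.deckGroup) →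
    l.foldl (fun g γ => diffOp γ g) f = 0}

/-- `F_∞ O_mod(Ct)`, the union of the `F_n O_mod(Ct)`. -/
def moderateFiltrationTop (L : LiftedDiscs φ U) : Set (Ct → ℂ) :=
  ⋃ n : ℕ, moderateFiltration L n

/-- Functions of Nilsson class on `C`, as functions on the universal cover: holomorphic, of finite
determination, and of moderate growth at the punctures. -/
def IsNilssonClass (L : LiftedDiscs φ U) (f : Ct → ℂ) : Prop :=
  f ∈ moderateFun L ∧ FiniteDetermination U f

end Punctures

/-! ## Pull-back of regular differentials and the minimal stable subalgebra -/

/-- Families of cotangent vectors on `X`, as a module over `A` acting through the functions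
`z ↦ q z a`. -/
def FormsOver {A X : Type*} [CommRing A] [Algebra ℂ A] [TopologicalSpace X] [ChartedSpace ℂ X]
    (_q : X → (A →ₐ[ℂ] ℂ)) : Type _ :=
  ∀ z : X, TangentSpace 𝓘(ℂ) z →L[ℂ] ℂ

section Forms

variable {A X : Type*} [CommRing A] [Algebra ℂ A] [TopologicalSpace X] [ChartedSpace ℂ X]

instance (q : X → (A →ₐ[ℂ] ℂ)) : AddCommGroup (FormsOver q) :=
  inferInstanceAs (AddCommGroup (∀ z : X, TangentSpace 𝓘(ℂ) z →L[ℂ] ℂ))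

instance (q : X → (A →ₐ[ℂ] ℂ)) : Module ℂ (FormsOver q) :=
  inferInstanceAs (Module ℂ (∀ z : X, TangentSpace 𝓘(ℂ) z →L[ℂ] ℂ))

/-- The cotangent vector of `η` at `z`. -/
def FormsOver.val {q : X → (A →ₐ[ℂ] ℂ)} (η : FormsOver q) (z : X) : TangentSpace 𝓘(ℂ) z →L[ℂ] ℂ :=
  η z

instance (q : X → (A →ₐ[ℂ] ℂ)) : Module A (FormsOver q) where
  smul a η := fun z => q z a • η.val z
  one_smul η := by
    funext z
    change q z 1 • η.val z = η.val z
    rw [map_one, one_smul]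
  mul_smul a b η := by
    funext z
    change q z (a * b) • η.val z = q z a • (q z b • η.val z)
    rw [map_mul, mul_smul]
  smul_zero a := by
    funext z
    exact smul_zero (A := TangentSpace 𝓘(ℂ) z →L[ℂ] ℂ) (q z a)
  smul_add a η η' := by
    funext z
    exact smul_add (q z a) (η.val z) (η'.val z)
  add_smul a b η := by
    funext z
    refine ContinuousLinearMap.ext fun v => ?_
    change q z (a + b) * η.val z v = q z a * η.val z v + q z b * η.val z v
    rw [map_add, add_mul]
  zero_smul η := by
    funext z
    refine ContinuousLinearMap.ext fun v => ?_
    change q z 0 * η.val z v = 0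
    rw [map_zero, zero_mul]

theorem formsOver_smul_apply (q : X → (A →ₐ[ℂ] ℂ)) (a : A) (η : FormsOver q) (z : X) :
    (a • η).val z = q z a • η.val z := rfl

instance (q : X → (A →ₐ[ℂ] ℂ)) : IsScalarTower ℂ A (FormsOver q) where
  smul_assoc c a η := by
    funext z
    change q z (c • a) • η.val z = c • (q z a • η.val z)
    rw [map_smul, smul_assoc]

/-- The derivation `a ↦ d(z ↦ q z a)`. -/
def pullbackDer (q : X → (A →ₐ[ℂ] ℂ))
    (hq : ∀ a, MDifferentiable 𝓘(ℂ) 𝓘(ℂ) (fun z => q z a)) : Derivation ℂ A (FormsOver q) :=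
  Derivation.mk'
    { toFun := fun a z => (mfderiv 𝓘(ℂ) 𝓘(ℂ) (fun z => q z a) z : TangentSpace 𝓘(ℂ) z →L[ℂ] ℂ)
      map_add' := by
        intro a b
        funext z
        have h : (fun z => q z (a + b)) = (fun z => q z a) + (fun z => q z b) := by
          funext z; exact map_add (q z) a b
        rw [h]
        exact mfderiv_add (hq a z) (hq b z)
      map_smul' := by
        intro c a
        funext z
        have h : (fun z => q z (c • a)) = c • (fun z => q z a) := by
          funext z; exact map_smul (q z) c a
        rw [h]
        exact const_smul_mfderiv (hq a z) c }
    (by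
      intro a b
      funext z
      have h : (fun z => q z (a * b)) = (fun z => q z a) * (fun z => q z b) := by
        funext z; exact map_mul (q z) a b
      have h' := ((hq a z).hasMFDerivAt.mul (hq b z).hasMFDerivAt).mfderiv
      change mfderiv 𝓘(ℂ) 𝓘(ℂ) (fun z => q z (a * b)) z = _
      rw [h]
      exact h')

/-- The pull-back of algebraic differentials: it sends `∑ a_i d b_i` to the form
`∑ (z ↦ q z a_i) d(z ↦ q z b_i)`. -/
def pullbackForm (q : X → (A →ₐ[ℂ] ℂ))
    (hq : ∀ a, MDifferentiable 𝓘(ℂ) 𝓘(ℂ) (fun z => q z a)) : Ω[A⁄ℂ] →ₗ[A] FormsOver q :=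
  (pullbackDer q hq).liftKaehlerDifferential

end Forms

section Stable

variable {A C Ct : Type*} [CommRing A] [Algebra ℂ A]
  [TopologicalSpace C] [ChartedSpace ℂ C] [TopologicalSpace Ct] [ChartedSpace ℂ Ct]

/-- The pull-back `p^*η` to the universal cover of a regular differential `η ∈ Ω(C)`. -/
def pullbackDifferential (an : Analytification A C) (U : UniversalCover C Ct) (η : Ω[A⁄ℂ])
    (z : Ct) : TangentSpace 𝓘(ℂ) z →L[ℂ] ℂ :=
  (pullbackForm (fun z => an.pt (U.p z))
    (fun a => (an.mdifferentiable a).comp U.mdifferentiable) η).val z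

/-- `g` is the function `z ↦ ∫_{z₀}^z f · p^*η`: it is holomorphic, vanishes at `z₀` and satisfies
`dg = f · p^*η`.  As `Ct` is simply connected there is, for `f` holomorphic, exactly one such `g`. -/
def IsIntegral (an : Analytification A C) (U : UniversalCover C Ct) (f : Ct → ℂ) (η : Ω[A⁄ℂ])
    (z₀ : Ct) (g : Ct → ℂ) : Prop :=
  g ∈ holFun Ct ∧ g z₀ = 0 ∧
    ∀ z, mfderiv 𝓘(ℂ) 𝓘(ℂ) g z = f z • pullbackDifferential an U η z

/-- Stable subalgebras of `O_hol(Ct)`: unital subalgebras stable under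
`f ↦ ∫_{z₀} f · p^*η` for all regular differentials `η` on `C` and all `z₀`. -/
def IsStableSubalgebra (an : Analytification A C) (U : UniversalCover C Ct)
    (B : Subalgebra ℂ (Ct → ℂ)) : Prop :=
  B ≤ holFun Ct ∧
    ∀ f ∈ B, ∀ (η : Ω[A⁄ℂ]) (z₀ : Ct) (g : Ct → ℂ), IsIntegral an U f η z₀ g → g ∈ B

/-- `A_C`, the minimal stable subalgebra: the intersection of all stable subalgebras. -/
def minimalStableSubalgebra (an : Analytification A C) (U : UniversalCover C Ct) :
    Subalgebra ℂ (Ct → ℂ) :=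
  sInf {B | IsStableSubalgebra an U B}

end Stable

end NilssonCurve

end

noncomputable section

namespace NilssonCurve

open Filter Topology

/-! ## Holomorphic functions of moderate growth on the half-plane -/

/-! Local side. Translation by 1 on the half-plane is induced by a deck transformation
(`LiftedDiscs.exists_monodromy`), so a function killed by all products of k operators γ - 1 pulls
back to F with (T - 1)^k F = 0, where T is the unit translation. Then G = (T - 1)^(k-1) F is
periodic and moderate, so it descends to a function on the punctured disc with at most a pole.
Subtracting u^(k-1) G / (k-1)! from F lowers k, and induction gives a polynomial in the logarithm
(`isLogPolynomial_of_fwdDiff_iterate_eq_zero`). As only finitely many coefficients occur, one power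
of z clears all their poles.

Global side. By minimality of A_C it is enough that the unipotent functions of Nilsson class form a
stable subalgebra (`isStableSubalgebra_unipotentNilsson`). Products are handled by a twisted Leibniz
rule for γ - 1. For primitives, p^*η is invariant under deck transformations, so γ - 1 commutes with
integration up to constants; this costs one more operator and preserves finite determination.
Moderate growth of a primitive requires that regular functions have at most poles at the punctures.
This is deduced from the finiteness of the fibres of a nonconstant regular function, by open mapping
and Baire category (`exists_pole_bound`), with no algebraic structure on the compactification.
Cauchy's estimate then bounds differentials. -/

theorem HolOn.add {F : Set ℂ} {f g : ℂ → ℂ} (hf : HolOn F f) (hg : HolOn F g) :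
    HolOn F (fun z => f z + g z) := ⟨hf.1.add hg.1, hf.2.add hg.2⟩

theorem HolOn.mul {F : Set ℂ} {f g : ℂ → ℂ} (hf : HolOn F f) (hg : HolOn F g) :
    HolOn F (fun z => f z * g z) := ⟨hf.1.mul hg.1, hf.2.mul hg.2⟩

theorem holOn_of_differentiable {f : ℂ → ℂ} (hf : Differentiable ℂ f) (F : Set ℂ) : HolOn F f :=
  ⟨hf.continuous.continuousOn, hf.differentiableOn⟩

/-- Working form of the definition: the exponent may be 0, since enlarging it weakens the bound for
im u ≥ 0, and a ≤ b is dropped, since an empty strip needs no bound. -/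
theorem moderateOnHalfPlane_iff {f : ℂ → ℂ} :
    ModerateOnHalfPlane f ↔ HolOn halfPlane f ∧ ∃ n : ℕ, ∀ a b : ℝ, ∃ K : ℝ, 0 ≤ K ∧
      ∀ u : ℂ, a ≤ u.re → u.re ≤ b → 0 ≤ u.im → ‖f u‖ ≤ K * Real.exp (2 * Real.pi * n * u.im) := by
  constructor
  · rintro ⟨h, n, -, K, hK⟩
    refine ⟨h, n, fun a b => ?_⟩
    by_cases hab : a ≤ b
    · refine ⟨K a b, (hK a b hab).1, fun u h1 h2 h3 => ?_⟩
      have := (hK a b hab).2 u.re u.im ⟨h1, h2⟩ h3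
      rwa [Complex.re_add_im] at this
    · exact ⟨0, le_rfl, fun u h1 h2 => absurd (h1.trans h2) hab⟩
  · rintro ⟨h, n, hn⟩
    choose K hK0 hK using hn
    refine ⟨h, n + 1, n.succ_pos, K, fun a b _ => ⟨hK0 a b, fun x y hx hy => ?_⟩⟩
    have := hK a b (x + y * Complex.I) (by simpa using hx.1) (by simpa using hx.2) (by simpa using hy)
    refine this.trans ?_
    have := hK0 a b
    have hp := Real.pi_pos
    gcongr
    · simpa using hy
    · simp
    · simp

theorem ModerateOnHalfPlane.add {f g : ℂ → ℂ} (hf : ModerateOnHalfPlane f)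
    (hg : ModerateOnHalfPlane g) : ModerateOnHalfPlane (fun u => f u + g u) := by
  rw [moderateOnHalfPlane_iff] at *
  obtain ⟨hf, n, hn⟩ := hf
  obtain ⟨hg, m, hm⟩ := hg
  refine ⟨hf.add hg, n + m, fun a b => ?_⟩
  obtain ⟨K, hK, hn⟩ := hn a b
  obtain ⟨K', hK', hm⟩ := hm a b
  refine ⟨K + K', add_nonneg hK hK', fun u h1 h2 h3 => ?_⟩
  refine (norm_add_le _ _).trans ?_
  rw [add_mul]
  have hp := Real.pi_pos
  refine add_le_add ((hn u h1 h2 h3).trans ?_) ((hm u h1 h2 h3).trans ?_) <;> gcongr <;> simp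

theorem ModerateOnHalfPlane.mul {f g : ℂ → ℂ} (hf : ModerateOnHalfPlane f)
    (hg : ModerateOnHalfPlane g) : ModerateOnHalfPlane (fun u => f u * g u) := by
  rw [moderateOnHalfPlane_iff] at *
  obtain ⟨hf, n, hn⟩ := hf
  obtain ⟨hg, m, hm⟩ := hg
  refine ⟨hf.mul hg, n + m, fun a b => ?_⟩
  obtain ⟨K, hK, hn⟩ := hn a b
  obtain ⟨K', hK', hm⟩ := hm a b
  refine ⟨K * K', mul_nonneg hK hK', fun u h1 h2 h3 => ?_⟩
  rw [norm_mul]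
  refine (mul_le_mul (hn u h1 h2 h3) (hm u h1 h2 h3) (norm_nonneg _) (by positivity)).trans_eq ?_
  rw [mul_mul_mul_comm, ← Real.exp_add]
  push_cast
  ring_nf

theorem moderateOnHalfPlane_const (c : ℂ) : ModerateOnHalfPlane (fun _ => c) := by
  rw [moderateOnHalfPlane_iff]
  refine ⟨holOn_of_differentiable (differentiable_const c) _, 0, fun a b => ⟨‖c‖, norm_nonneg _, ?_⟩⟩
  simp

theorem moderateOnHalfPlane_id : ModerateOnHalfPlane (fun u => u) := by
  rw [moderateOnHalfPlane_iff]
  refine ⟨holOn_of_differentiable differentiable_id _, 1, fun a b => ⟨max |a| |b| + 1, by positivity, ?_⟩⟩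
  intro u h1 h2 h3
  have h4 : |u.re| ≤ max |a| |b| := abs_le_max_abs_abs h1 h2
  have h5 : u.im + 1 ≤ Real.exp (2 * Real.pi * (1 : ℕ) * u.im) := by
    refine le_trans ?_ (Real.add_one_le_exp _)
    have := Real.pi_gt_three
    push_cast
    nlinarith
  have h6 := Complex.norm_le_abs_re_add_abs_im u
  rw [abs_of_nonneg h3] at h6
  have h7 : 0 ≤ max |a| |b| := (abs_nonneg a).trans (le_max_left _ _)
  nlinarith

theorem ModerateOnHalfPlane.pow {f : ℂ → ℂ} (hf : ModerateOnHalfPlane f) (n : ℕ) :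
    ModerateOnHalfPlane (fun u => f u ^ n) := by
  induction n with
  | zero => simpa using moderateOnHalfPlane_const 1
  | succ n ih => simpa only [pow_succ] using ih.mul hf

theorem interior_halfPlane : interior halfPlane = {u : ℂ | 0 < u.im} :=
  Complex.interior_setOfPred_le_im 0

theorem add_one_mem_halfPlane {u : ℂ} (hu : u ∈ halfPlane) : u + 1 ∈ halfPlane := by
  simpa [halfPlane] using hu

theorem ModerateOnHalfPlane.comp_add_one {f : ℂ → ℂ} (hf : ModerateOnHalfPlane f) :
    ModerateOnHalfPlane (fun u => f (u + 1)) := by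
  rw [moderateOnHalfPlane_iff] at *
  obtain ⟨⟨hc, hd⟩, n, hn⟩ := hf
  refine ⟨⟨hc.comp (by fun_prop) fun u hu => add_one_mem_halfPlane hu, hd.comp (by fun_prop) ?_⟩, n,
    fun a b => ?_⟩
  · intro u hu
    rw [interior_halfPlane] at *
    simpa using hu
  · obtain ⟨K, hK, hn⟩ := hn (a + 1) (b + 1)
    refine ⟨K, hK, fun u h1 h2 h3 => ?_⟩
    simpa using hn (u + 1) (by simpa using h1) (by simpa using h2) (by simpa using h3)

theorem ModerateOnHalfPlane.fwdDiff {f : ℂ → ℂ} (hf : ModerateOnHalfPlane f) :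
    ModerateOnHalfPlane (fwdDiff 1 f) := by
  have := hf.comp_add_one.add ((moderateOnHalfPlane_const (-1)).mul hf)
  convert this using 2 with u
  simp [_root_.fwdDiff, sub_eq_add_neg]

theorem ModerateOnHalfPlane.fwdDiff_iterate {f : ℂ → ℂ} (hf : ModerateOnHalfPlane f) (n : ℕ) :
    ModerateOnHalfPlane ((_root_.fwdDiff 1)^[n] f) := by
  induction n with
  | zero => exact hf
  | succ n ih => rw [Function.iterate_succ_apply']; exact ih.fwdDiff

/-! ## Descent of periodic functions to the punctured disc -/

theorem expMap_ne_zero (u : ℂ) : expMap u ≠ 0 := Complex.exp_ne_zero _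

theorem norm_expMap (u : ℂ) : ‖expMap u‖ = Real.exp (-(2 * Real.pi * u.im)) := by
  simp [expMap, Complex.norm_exp]

theorem expMap_mem_puncturedDisc {u : ℂ} : expMap u ∈ puncturedDisc ↔ u ∈ halfPlane := by
  have hp := Real.pi_pos
  simp [puncturedDisc, disc, expMap_ne_zero, norm_expMap, halfPlane, hp]

theorem expMap_mem_ball {u : ℂ} : expMap u ∈ Metric.ball (0 : ℂ) 1 ↔ 0 < u.im := by
  have hp := Real.pi_pos
  simp [norm_expMap, hp]

theorem expMap_add_one (u : ℂ) : expMap (u + 1) = expMap u := by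
  rw [expMap, mul_add, mul_one]
  exact Complex.exp_periodic _

theorem interior_disc : interior disc = Metric.ball (0 : ℂ) 1 := interior_closedBall _ one_ne_zero

theorem interior_puncturedDisc : interior puncturedDisc = Metric.ball (0 : ℂ) 1 \ {0} := by
  rw [puncturedDisc, Set.sdiff_eq, interior_inter, interior_disc,
    isOpen_compl_singleton.interior_eq, Set.sdiff_eq]

/-- The branch of `log z / 2πi` near `expMap u₀` with value `u₀` there. -/
def logBranch (u₀ z : ℂ) : ℂ := u₀ + Complex.log (z / expMap u₀) / (2 * Real.pi * Complex.I)

theorem expMap_logBranch (u₀ : ℂ) {z : ℂ} (hz : z ≠ 0) : expMap (logBranch u₀ z) = z := by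
  rw [logBranch, expMap, mul_add, mul_div_cancel₀ _ Complex.two_pi_I_ne_zero, Complex.exp_add,
    Complex.exp_log (div_ne_zero hz (expMap_ne_zero _))]
  exact mul_div_cancel₀ _ (expMap_ne_zero u₀)

theorem logBranch_self (u₀ : ℂ) : logBranch u₀ (expMap u₀) = u₀ := by
  simp [logBranch, div_self (expMap_ne_zero u₀)]

theorem differentiableAt_logBranch (u₀ : ℂ) : DifferentiableAt ℂ (logBranch u₀) (expMap u₀) := by
  unfold logBranch
  refine (DifferentiableAt.clog (by fun_prop) ?_).div_const _ |>.const_add _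
  rw [div_self (expMap_ne_zero u₀)]
  exact Complex.one_mem_slitPlane

theorem exists_expMap_eq {z : ℂ} (hz : z ≠ 0) : ∃ u, expMap u = z :=
  ⟨_, expMap_logBranch 0 hz⟩

/-- Only values matter here: g is defined through one discontinuous logarithm, and periodicity makes
the choice irrelevant. Regularity is recovered separately with local branches. -/
theorem exists_descent {G : ℂ → ℂ} (hper : ∀ u ∈ halfPlane, G (u + 1) = G u) :
    ∃ g : ℂ → ℂ, ∀ u ∈ halfPlane, g (expMap u) = G u := by
  refine ⟨fun z => G (logBranch 0 z), fun u hu => ?_⟩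
  have hnat : ∀ (n : ℕ) (v : ℂ), v ∈ halfPlane → G (v + n) = G v := by
    intro n
    induction n with
    | zero => simp
    | succ n ih =>
      intro v hv
      push_cast
      rw [← add_assoc, hper _ (by simpa [halfPlane] using hv), ih v hv]
  have h := expMap_logBranch 0 (expMap_ne_zero u)
  rw [expMap, expMap, Complex.exp_eq_exp_iff_exists_int] at h
  obtain ⟨n, hn⟩ := h
  have h1 : logBranch 0 (expMap u) = u + n := by
    refine mul_left_cancel₀ Complex.two_pi_I_ne_zero ?_
    rw [expMap, hn]; ring
  have hu' : u + n ∈ halfPlane := by simpa [halfPlane] using hu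
  change G (logBranch 0 (expMap u)) = G u
  rw [h1]
  obtain ⟨m, rfl | rfl⟩ := n.eq_nat_or_neg
  · exact_mod_cast hnat m u hu
  -- For a negative shift, start from the translated point, which is still in the half-plane.
  · rw [← hnat m _ hu']
    congr 1
    push_cast; ring

/-- Near `expMap u₀` the branch of the logarithm centred at `u₀` is holomorphic, and g is G composed
with it. Every branch sends the whole punctured disc into the half-plane, so boundary points need no
separate treatment. -/
theorem holOn_puncturedDisc_of_comp {G g : ℂ → ℂ} (hG : HolOn halfPlane G)
    (h : ∀ u ∈ halfPlane, g (expMap u) = G u) : HolOn puncturedDisc g := by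
  have key : ∀ u₀, ∀ z ∈ puncturedDisc, g z = G (logBranch u₀ z) ∧ logBranch u₀ z ∈ halfPlane := by
    intro u₀ z hz
    have h1 := expMap_logBranch u₀ hz.2
    have h2 : logBranch u₀ z ∈ halfPlane := by rw [← expMap_mem_puncturedDisc, h1]; exact hz
    exact ⟨by rw [← h _ h2, h1], h2⟩
  constructor
  · intro z hz
    obtain ⟨u₀, rfl⟩ := exists_expMap_eq hz.2
    have hc : ContinuousWithinAt (fun z => G (logBranch u₀ z)) puncturedDisc (expMap u₀) := by
      refine ContinuousWithinAt.comp (t := halfPlane) ?_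
        (differentiableAt_logBranch u₀).continuousAt.continuousWithinAt fun z hz => (key u₀ z hz).2
      rw [logBranch_self]
      exact hG.1 _ (expMap_mem_puncturedDisc.1 hz)
    exact hc.congr (fun z hz => (key u₀ z hz).1) (key u₀ _ hz).1
  · intro z hz
    have hz' := interior_subset hz
    obtain ⟨u₀, rfl⟩ := exists_expMap_eq hz'.2
    have hu₀ : u₀ ∈ interior halfPlane := by
      rw [interior_halfPlane]
      rw [interior_puncturedDisc] at hz
      exact expMap_mem_ball.1 hz.1
    have hc : DifferentiableAt ℂ (fun z => G (logBranch u₀ z)) (expMap u₀) := by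
      refine DifferentiableAt.comp _ ?_ (differentiableAt_logBranch u₀)
      rw [logBranch_self]
      exact hG.2.differentiableAt (isOpen_interior.mem_nhds hu₀)
    refine (hc.congr_of_eventuallyEq ?_).differentiableWithinAt
    filter_upwards [isOpen_interior.mem_nhds hz] with z hz
    exact (key u₀ z (interior_subset hz)).1

/-- A function on the punctured disc with at most polynomial growth at `0` is meromorphic there. -/
theorem meroAtZero_of_norm_le {g : ℂ → ℂ} (hg : HolOn puncturedDisc g) (n : ℕ) (K : ℝ)
    (h : ∀ z ∈ puncturedDisc, ‖z ^ n * g z‖ ≤ K) : MeroAtZero g := by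
  -- The extra factor z forces the limit 0 at the origin, so the extension is explicit and
  -- continuous there, and the singularity is removable.
  refine ⟨hg, n + 1, Function.update (fun z => z ^ (n + 1) * g z) 0 0, ?_, ?_⟩
  swap
  · intro z hz
    rw [Function.update_of_ne hz.2]
  set f := Function.update (fun z => z ^ (n + 1) * g z) 0 0 with hf
  have hbound : ∀ z ∈ disc, ‖f z‖ ≤ ‖z‖ * K := by
    intro z hz
    by_cases h0 : z = 0
    · simp [h0, hf]
    · rw [hf, Function.update_of_ne h0, pow_succ', mul_assoc, norm_mul]
      exact mul_le_mul_of_nonneg_left (h z ⟨hz, h0⟩) (norm_nonneg _)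
  have hdn : disc ∈ 𝓝 (0 : ℂ) := Metric.closedBall_mem_nhds _ one_pos
  have hc0 : ContinuousAt f 0 := by
    have h0 : f 0 = 0 := by simp [hf]
    rw [ContinuousAt, h0]
    refine squeeze_zero_norm' (a := fun z => ‖z‖ * K) ?_ ?_
    · filter_upwards [hdn] with z hz using hbound z hz
    · have : Continuous fun z : ℂ => ‖z‖ * K := by fun_prop
      simpa using this.tendsto 0
  have hcp : HolOn puncturedDisc fun z => z ^ (n + 1) * g z :=
    (holOn_of_differentiable (by fun_prop) _).mul hg
  constructor
  · intro z hz
    by_cases h0 : z = 0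
    · rw [h0]; exact hc0.continuousWithinAt
    · have := hcp.1 z ⟨hz, h0⟩
      have h1 : ContinuousWithinAt (fun z => z ^ (n + 1) * g z) disc z :=
        (continuousWithinAt_inter (isOpen_compl_singleton.mem_nhds h0)).1 this
      refine h1.congr_of_eventuallyEq ?_ (by rw [hf, Function.update_of_ne h0])
      filter_upwards [mem_nhdsWithin_of_mem_nhds (isOpen_compl_singleton.mem_nhds h0)] with w hw
      rw [hf, Function.update_of_ne hw]
  · rw [interior_disc, ← Complex.differentiableOn_compl_singleton_and_continuousAt_iff
      (Metric.ball_mem_nhds 0 one_pos)]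
    refine ⟨?_, hc0⟩
    rw [← interior_puncturedDisc]
    refine hcp.2.congr fun z hz => ?_
    rw [hf, Function.update_of_ne (interior_subset hz).2]

theorem exists_meroAtZero_of_periodic {G : ℂ → ℂ} (hG : ModerateOnHalfPlane G)
    (hper : ∀ u ∈ halfPlane, G (u + 1) = G u) :
    ∃ g : ℂ → ℂ, MeroAtZero g ∧ ∀ u ∈ halfPlane, g (expMap u) = G u := by
  obtain ⟨g, hg⟩ := exists_descent hper
  obtain ⟨hol, n, hn⟩ := moderateOnHalfPlane_iff.1 hG
  -- The principal logarithm has argument in [-π, π], so one strip of bounded width already covers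
  -- the punctured disc.
  obtain ⟨K, hK, hn⟩ := hn (-1) 1
  refine ⟨g, meroAtZero_of_norm_le (holOn_puncturedDisc_of_comp hol hg) n K ?_, hg⟩
  intro z hz
  have h1 := expMap_logBranch 0 hz.2
  set u := logBranch 0 z with hu
  have h2 : u ∈ halfPlane := by rw [← expMap_mem_puncturedDisc, h1]; exact hz
  have h3 : |u.re| ≤ 1 := by
    have hp := Real.pi_pos
    have h4 : u.re = Complex.arg z / (2 * Real.pi) := by
      rw [hu, logBranch, expMap]
      simp [Complex.div_re, Complex.normSq, Complex.log_im]
      field_simp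
    rw [h4, abs_div, abs_of_pos (by positivity : 0 < 2 * Real.pi), div_le_one (by positivity)]
    exact (Complex.abs_arg_le_pi z).trans (by linarith)
  rw [← h1, hg u h2, norm_mul, norm_pow, norm_expMap, ← Real.exp_nat_mul]
  refine (mul_le_mul_of_nonneg_left (hn u (abs_le.1 h3).1 (abs_le.1 h3).2 h2)
    (Real.exp_pos _).le).trans_eq ?_
  rw [mul_left_comm, ← Real.exp_add]
  ring_nf
  simp

/-! ## Polynomials in the logarithm -/

theorem MeroAtZero.add {f g : ℂ → ℂ} (hf : MeroAtZero f) (hg : MeroAtZero g) :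
    MeroAtZero (fun z => f z + g z) := by
  obtain ⟨hf, n, h, hh, hn⟩ := hf
  obtain ⟨hg, m, k, hk, hm⟩ := hg
  refine ⟨hf.add hg, n + m, fun z => z ^ m * h z + z ^ n * k z,
    ((holOn_of_differentiable (by fun_prop) _).mul hh).add
      ((holOn_of_differentiable (by fun_prop) _).mul hk), fun z hz => ?_⟩
  beta_reduce
  rw [hn z hz, hm z hz]; ring

theorem MeroAtZero.const_mul {f : ℂ → ℂ} (hf : MeroAtZero f) (c : ℂ) :
    MeroAtZero (fun z => c * f z) := by
  obtain ⟨hf, n, h, hh, hn⟩ := hf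
  refine ⟨(holOn_of_differentiable (differentiable_const c) _).mul hf, n, fun z => c * h z,
    (holOn_of_differentiable (differentiable_const c) _).mul hh, fun z hz => ?_⟩
  beta_reduce
  rw [hn z hz]; ring

theorem meroAtZero_zero : MeroAtZero (fun _ => 0) :=
  ⟨holOn_of_differentiable (differentiable_const 0) _, 0, fun _ => 0,
    holOn_of_differentiable (differentiable_const 0) _, by simp⟩

theorem IsLogPolynomial.add {F G : ℂ → ℂ} (hF : IsLogPolynomial F) (hG : IsLogPolynomial G) :
    IsLogPolynomial (fun u => F u + G u) := by
  obtain ⟨N, f, hf, hN⟩ := hF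
  obtain ⟨M, g, hg, hM⟩ := hG
  refine ⟨max N M, fun k z => (if k < N then f k z else 0) + (if k < M then g k z else 0), ?_, ?_⟩
  · intro k
    refine MeroAtZero.add ?_ ?_
    · split_ifs
      exacts [hf k, meroAtZero_zero]
    · split_ifs
      exacts [hg k, meroAtZero_zero]
  · intro u hu
    have aux : ∀ (N' : ℕ) (c : ℕ → ℂ), N' ≤ max N M →
        ∑ k ∈ Finset.range N', c k * logFun u ^ k =
          ∑ k ∈ Finset.range (max N M), (if k < N' then c k else 0) * logFun u ^ k := by
      intro N' c h
      simp only [ite_mul, zero_mul]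
      rw [← Finset.sum_filter]
      refine Finset.sum_congr ?_ fun _ _ => rfl
      ext k
      simp only [Finset.mem_range, Finset.mem_filter]
      omega
    beta_reduce
    rw [hN u hu, hM u hu, aux N (fun k => f k (expMap u)) (le_max_left _ _),
      aux M (fun k => g k (expMap u)) (le_max_right _ _), ← Finset.sum_add_distrib]
    exact Finset.sum_congr rfl fun k _ => by ring

theorem isLogPolynomial_monomial {g : ℂ → ℂ} (hg : MeroAtZero g) (n : ℕ) :
    IsLogPolynomial (fun u => g (expMap u) * logFun u ^ n) := by
  refine ⟨n + 1, fun k z => if k = n then g z else 0, fun k => ?_, fun u _ => ?_⟩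
  · by_cases hk : k = n
    · simpa [hk] using hg
    · simpa [hk] using meroAtZero_zero
  · rw [Finset.sum_eq_single n] <;> simp +contextual

theorem IsLogPolynomial.congr {F G : ℂ → ℂ} (hF : IsLogPolynomial F)
    (h : ∀ u ∈ halfPlane, G u = F u) : IsLogPolynomial G := by
  obtain ⟨N, f, hf, hN⟩ := hF
  exact ⟨N, f, hf, fun u hu => by rw [h u hu, hN u hu]⟩

/-- A periodic factor behaves as a constant for the difference operator, and the n-th difference of
u^n is n!. -/
theorem fwdDiff_iterate_pow_mul {G : ℂ → ℂ} (hper : ∀ u ∈ halfPlane, G (u + 1) = G u) (n : ℕ)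
    {u : ℂ} (hu : u ∈ halfPlane) :
    (fwdDiff 1)^[n] (fun v => v ^ n * G v) u = n.factorial * G u := by
  have hnat : ∀ (k : ℕ), G (u + k) = G u := by
    intro k
    induction k with
    | zero => simp
    | succ k ih =>
      push_cast
      rw [← add_assoc, hper _ (by simpa [halfPlane] using hu), ih]
  have h := congrFun (fwdDiff_iter_eq_factorial (R := ℂ) (n := n)) u
  rw [fwdDiff_iter_eq_sum_shift] at h ⊢
  simp only [Pi.natCast_apply] at h
  rw [← h, Finset.sum_mul]
  refine Finset.sum_congr rfl fun k _ => ?_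
  simp [hnat, mul_assoc]

/-- A function of moderate growth killed by a power of `T - 1`, `T` the unit translation, is a
polynomial in the logarithm. -/
theorem isLogPolynomial_of_fwdDiff_iterate_eq_zero (n : ℕ) : ∀ F : ℂ → ℂ, ModerateOnHalfPlane F →
    (∀ u ∈ halfPlane, (fwdDiff 1)^[n] F u = 0) → IsLogPolynomial F := by
  induction n with
  | zero =>
    intro F _ h
    exact ⟨0, fun _ _ => 0, fun _ => meroAtZero_zero, fun u hu => by simpa using h u hu⟩
  | succ n ih =>
    intro F hF h
    set G := (fwdDiff 1)^[n] F with hGdef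
    have hG : ModerateOnHalfPlane G := hF.fwdDiff_iterate n
    have hper : ∀ u ∈ halfPlane, G (u + 1) = G u := by
      intro u hu
      have := h u hu
      rw [Function.iterate_succ_apply'] at this
      exact sub_eq_zero.1 this
    obtain ⟨g, hg, hgG⟩ := exists_meroAtZero_of_periodic hG hper
    set c : ℂ := (n.factorial : ℂ)⁻¹ with hc
    -- The correction term has the same n-th difference G as F, so the difference of the two falls
    -- under the induction hypothesis.
    have hF' : ModerateOnHalfPlane fun u => F u + (-c) * (u ^ n * G u) :=
      hF.add ((moderateOnHalfPlane_const _).mul ((moderateOnHalfPlane_id.pow n).mul hG))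
    have h1 := ih _ hF' fun u hu => by
      have e1 : (fun u => F u + (-c) * (u ^ n * G u)) =
          F + (-c) • (fun u => u ^ n * G u) := by
        ext; simp
      rw [e1, fwdDiff_iter_add, fwdDiff_iter_const_smul, Pi.add_apply, Pi.smul_apply,
        fwdDiff_iterate_pow_mul hper n hu, ← hGdef, smul_eq_mul, hc]
      have : (n.factorial : ℂ) ≠ 0 := by exact_mod_cast n.factorial_ne_zero
      field_simp
      ring
    -- The power of 2πi converts u^n into (log z)^n.
    have h2 := isLogPolynomial_monomial (hg.const_mul (c * (2 * Real.pi * Complex.I)⁻¹ ^ n)) n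
    refine (h1.add h2).congr fun u hu => ?_
    rw [hgG u hu, logFun, mul_pow]
    have := Complex.two_pi_I_ne_zero
    have e : ((2 * Real.pi * Complex.I : ℂ)⁻¹ ^ n) * (2 * Real.pi * Complex.I : ℂ) ^ n = 1 := by
      rw [← mul_pow, inv_mul_cancel₀ this, one_pow]
    linear_combination (-(c * G u * u ^ n)) * e

theorem IsLogPolynomial.hasIntegralNilssonExpansion {F : ℂ → ℂ} (hF : IsLogPolynomial F) :
    HasIntegralNilssonExpansion F := by
  obtain ⟨N, g, hg, hN⟩ := hF
  choose _ n h hh hn using hg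
  -- The sum of the pole orders serves as a common bound for them.
  set M := ∑ k ∈ Finset.range N, n k with hM
  refine ⟨-(M : ℤ), N, fun k z => z ^ (M - n k) * h k z, fun k =>
    (holOn_of_differentiable (by fun_prop) _).mul (hh k), fun u hu => ?_⟩
  rw [hN u hu, Finset.mul_sum]
  refine Finset.sum_congr rfl fun k hk => ?_
  have hk' : n k ≤ M := Finset.single_le_sum (f := n) (fun _ _ => Nat.zero_le _) hk
  beta_reduce
  rw [hn k _ (expMap_mem_puncturedDisc.2 hu), zpow_neg, zpow_natCast]
  have he : expMap u ^ M = expMap u ^ (M - n k) * expMap u ^ n k := by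
    rw [← pow_add, Nat.sub_add_cancel hk']
  have h0 : expMap u ^ M ≠ 0 := pow_ne_zero _ (expMap_ne_zero u)
  field_simp
  rw [he]
  ring

/-! ## Functions on the punctured disc with finite fibres have at most a pole -/

/-- A Casorati–Weierstrass argument with Baire category in place of Picard's theorem. Finite fibres
make α nowhere locally constant, so the images of the shrinking punctured balls are open. If all
were dense, some value would lie in all of them and be taken at points tending to 0, giving an
infinite fibre. -/
theorem exists_pole_bound {α : ℂ → ℂ} (hd : DifferentiableOn ℂ α (Metric.ball 0 1 \ {0}))
    (hfin : ∀ c, {z ∈ Metric.ball (0 : ℂ) 1 \ {0} | α z = c}.Finite) :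
    ∃ (m : ℕ) (K r : ℝ), 0 < r ∧ ∀ z : ℂ, z ≠ 0 → ‖z‖ < r → ‖z ^ m * α z‖ ≤ K := by
  have hBo : ∀ r : ℝ, IsOpen (Metric.ball (0 : ℂ) r \ {0}) := fun r =>
    Metric.isOpen_ball.sdiff isClosed_singleton
  set W : ℕ → Set ℂ := fun n => α '' (Metric.ball 0 (1 / ((n : ℝ) + 1)) \ {0}) with hW
  have hsub : ∀ n : ℕ, Metric.ball (0 : ℂ) (1 / ((n : ℝ) + 1)) \ {0} ⊆ Metric.ball 0 1 \ {0} := by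
    intro n
    refine Set.sdiff_subset_sdiff_left (Metric.ball_subset_ball ?_)
    rw [div_le_one (by positivity)]
    simp
  have hWo : ∀ n, IsOpen (W n) := by
    intro n
    rw [isOpen_iff_mem_nhds]
    rintro _ ⟨z, hz, rfl⟩
    have han : AnalyticAt ℂ α z := hd.analyticAt ((hBo 1).mem_nhds (hsub n hz))
    rcases han.eventually_constant_or_nhds_le_map_nhds with h | h
    · exact absurd (hfin (α z)) (infinite_of_mem_nhds z
        (inter_mem ((hBo 1).mem_nhds (hsub n hz)) h))
    · exact h (image_mem_map ((hBo _).mem_nhds hz))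
  by_cases hdense : ∀ n, Dense (W n)
  · obtain ⟨c, hc⟩ := (dense_iInter_of_isOpen_nat hWo hdense).nonempty
    have h0 : (0 : ℂ) ∉ {z ∈ Metric.ball (0 : ℂ) 1 \ {0} | α z = c} := fun h => h.1.2 rfl
    -- A finite fibre is closed and omits 0, so it avoids a ball around 0.
    obtain ⟨ε, hε, hball⟩ := Metric.isOpen_iff.1 (hfin c).isClosed.isOpen_compl 0 h0
    obtain ⟨n, hn⟩ := exists_nat_one_div_lt hε
    obtain ⟨z, hz, hzc⟩ := Set.mem_iInter.1 hc n
    exact absurd ⟨hsub n hz, hzc⟩ (hball (Metric.ball_subset_ball hn.le hz.1))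
  · push Not at hdense
    obtain ⟨n, hn⟩ := hdense
    have : ∃ c, c ∉ closure (W n) := by
      by_contra! h
      exact hn h
    obtain ⟨c, hc⟩ := this
    obtain ⟨ε, hε, hball⟩ := Metric.isOpen_iff.1 isClosed_closure.isOpen_compl c hc
    set R : ℝ := 1 / ((n : ℝ) + 1) with hR
    have hR0 : 0 < R := by positivity
    have hdist : ∀ z ∈ Metric.ball (0 : ℂ) R \ {0}, ε ≤ ‖α z - c‖ := by
      intro z hz
      by_contra! h
      exact hball (show α z ∈ Metric.ball c ε by rwa [mem_ball_iff_norm])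
        (subset_closure ⟨z, hz, rfl⟩)
    have hne : ∀ z ∈ Metric.ball (0 : ℂ) R \ {0}, α z - c ≠ 0 := fun z hz h => by
      have := hdist z hz
      rw [h, norm_zero] at this
      linarith
    -- Values of α stay at distance at least ε from c, so 1/(α - c) is bounded and extends over 0;
    -- inverting it shows that α is meromorphic.
    have hH := Complex.differentiableOn_update_limUnder_of_bddAbove (f := fun z => (α z - c)⁻¹)
      (Metric.ball_mem_nhds 0 hR0) (((hd.mono (hsub n)).sub_const c).inv hne) (by
        refine ⟨ε⁻¹, ?_⟩
        rintro _ ⟨z, hz, rfl⟩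
        simp only [Function.comp, norm_inv]
        exact inv_anti₀ hε (hdist z hz))
    have hmer := (hH.analyticAt (Metric.ball_mem_nhds 0 hR0)).meromorphicAt
    have hmer2 : MeromorphicAt α 0 := by
      refine (hmer.inv.add (MeromorphicAt.const c 0)).congr ?_
      filter_upwards [self_mem_nhdsWithin] with z hz
      simp [Function.update_of_ne hz]
    obtain ⟨m, hm⟩ := hmer2
    obtain ⟨r, hr, hb⟩ := Metric.eventually_nhds_iff.1
      (hm.continuousAt.norm.eventually_lt_const (lt_add_one _))
    exact ⟨m, _, r, hr, fun z _ hz => (by simpa using hb (y := z) (by simpa using hz) : _ < _).le⟩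

/-! ## Fibres of a regular function on an affine curve -/

/-- A character is determined by its kernel. In a domain of dimension one the kernels in question
are minimal primes over the nonzero element a - c, and a noetherian ring has finitely many of those.
-/
theorem finite_setOf_algHom_apply_eq {A : Type*} [CommRing A] [IsDomain A] [Algebra ℂ A]
    [IsNoetherianRing A] (hdim : ringKrullDim A = 1) {a : A} {c : ℂ} (ha : a ≠ algebraMap ℂ A c) :
    {χ : A →ₐ[ℂ] ℂ | χ a = c}.Finite := by
  have : Ring.KrullDimLE 1 A := by
    rw [Ring.krullDimLE_iff, hdim]; rfl
  have hinj : Function.Injective fun χ : A →ₐ[ℂ] ℂ => RingHom.ker χ := by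
    intro χ χ' h
    ext b
    have h1 : b - algebraMap ℂ A (χ b) ∈ RingHom.ker χ := by
      simp [RingHom.mem_ker]
    rw [show RingHom.ker χ = RingHom.ker χ' from h] at h1
    have h2 : χ' b - χ b = 0 := by simpa [RingHom.mem_ker] using h1
    exact (sub_eq_zero.1 h2).symm
  refine Set.Finite.of_finite_image (f := fun χ : A →ₐ[ℂ] ℂ => RingHom.ker χ) ?_ hinj.injOn
  refine ((Ideal.span {a - algebraMap ℂ A c}).finite_minimalPrimes_of_isNoetherianRing A).subset ?_
  rintro _ ⟨χ, hχ, rfl⟩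
  have hχ : χ a = c := hχ
  refine ⟨⟨RingHom.ker_isPrime _, ?_⟩, ?_⟩
  · rw [Ideal.span_singleton_le_iff_mem]
    simp [RingHom.mem_ker, hχ]
  · rintro q ⟨hq, hqa⟩ hle
    rw [Ideal.span_singleton_le_iff_mem] at hqa
    have hq0 : q ≠ ⊥ := by
      rintro rfl
      exact ha (sub_eq_zero.1 hqa)
    have := Ring.krullDimLE_one_iff_of_noZeroDivisors.1 ‹_› q hq0 hq
    exact (this.eq_of_le (RingHom.ker_ne_top _) hle).ge

/-! ## Holomorphic local homeomorphisms -/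

/-- The inverse of a holomorphic homeomorphism between open sets of `ℂ` is holomorphic. -/
theorem _root_.OpenPartialHomeomorph.differentiableOn_symm_of_complex
    (E : OpenPartialHomeomorph ℂ ℂ) (hE : DifferentiableOn ℂ E E.source) :
    DifferentiableOn ℂ E.symm E.target := by
  intro w₀ hw₀
  have hz₀ := E.map_target hw₀
  set z₀ := E.symm w₀ with hz₀def
  have hsrc : E.source ∈ 𝓝 z₀ := E.open_source.mem_nhds hz₀
  have han : AnalyticAt ℂ E z₀ := hE.analyticAt hsrc
  have hcont : ContinuousAt E.symm w₀ := E.continuousAt_symm hw₀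
  -- No nonvanishing of the derivative at the point is needed: its zeros are isolated, for otherwise
  -- `E` would be locally constant and not injective. The inverse is thus differentiable nearby, and
  -- continuity removes the singularity.
  refine (Complex.analyticAt_of_differentiable_on_punctured_nhds_of_continuousAt ?_
    hcont).differentiableAt.differentiableWithinAt
  rcases han.deriv.eventually_eq_zero_or_eventually_ne_zero with h | h
  · exfalso
    obtain ⟨ε, hε, hball⟩ := Metric.eventually_nhds_iff_ball.1 (h.and hsrc)
    have hconst : ∀ z ∈ Metric.ball z₀ ε, E z = E z₀ := fun z hz =>
      Metric.isOpen_ball.is_const_of_deriv_eq_zero (convex_ball z₀ ε).isPreconnected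
        (hE.mono fun z hz => (hball z hz).2) (fun z hz => (hball z hz).1) hz
        (Metric.mem_ball_self hε)
    have hsub : Metric.ball z₀ ε ⊆ {z₀} := fun z hz =>
      E.injOn (hball z hz).2 hz₀ (hconst z hz)
    exact infinite_of_mem_nhds z₀ (Metric.ball_mem_nhds z₀ hε) ((Set.finite_singleton z₀).subset hsub)
  · have ht : Tendsto E.symm (𝓝[≠] w₀) (𝓝[≠] z₀) := by
      refine tendsto_nhdsWithin_iff.2 ⟨hcont.tendsto.mono_left nhdsWithin_le_nhds, ?_⟩
      filter_upwards [self_mem_nhdsWithin,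
        mem_nhdsWithin_of_mem_nhds (E.open_target.mem_nhds hw₀)] with w hw hwt h
      exact hw (E.symm.injOn hwt hw₀ h)
    filter_upwards [ht.eventually h,
      mem_nhdsWithin_of_mem_nhds (E.open_target.mem_nhds hw₀)] with w hw hwt
    exact (E.hasDerivAt_symm hwt hw
      (hE.differentiableAt (E.open_source.mem_nhds (E.map_target hwt))).hasDerivAt).differentiableAt

section Manifold

variable {M N X : Type*} [TopologicalSpace M] [ChartedSpace ℂ M] [IsManifold 𝓘(ℂ) ω M]
  [TopologicalSpace N] [ChartedSpace ℂ N] [IsManifold 𝓘(ℂ) ω N]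
  [TopologicalSpace X] [ChartedSpace ℂ X]

theorem mdifferentiableAt_symm_of_mdifferentiable {e : OpenPartialHomeomorph M N}
    (he : MDifferentiable 𝓘(ℂ) 𝓘(ℂ) e) {n₀ : N} (hn₀ : n₀ ∈ e.target) :
    MDifferentiableAt 𝓘(ℂ) 𝓘(ℂ) e.symm n₀ := by
  have : IsManifold 𝓘(ℂ) 1 M := .of_le (n := ω) le_top
  have : IsManifold 𝓘(ℂ) 1 N := .of_le (n := ω) le_top
  set φ := chartAt ℂ (e.symm n₀) with hφ
  set ψ := chartAt ℂ n₀ with hψ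
  have hφa : φ ∈ atlas ℂ M := chart_mem_atlas ℂ _
  have hψa : ψ ∈ atlas ℂ N := chart_mem_atlas ℂ _
  set E : OpenPartialHomeomorph ℂ ℂ := (φ.symm.trans e).trans ψ with hE
  have hEd : DifferentiableOn ℂ E E.source := by
    intro z hz
    simp only [hE, OpenPartialHomeomorph.trans_source, OpenPartialHomeomorph.symm_source,
      Set.mem_inter_iff, Set.mem_preimage, OpenPartialHomeomorph.coe_trans,
      Function.comp_apply] at hz
    refine DifferentiableAt.differentiableWithinAt ?_
    rw [← mdifferentiableAt_iff_differentiableAt]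
    exact MDifferentiableAt.comp (f := e ∘ φ.symm) z (mdifferentiableAt_atlas hψa hz.2)
      (MDifferentiableAt.comp z (he _) (mdifferentiableAt_atlas_symm hφa hz.1.1))
  have hEs := E.differentiableOn_symm_of_complex hEd
  have hn₀E : ψ n₀ ∈ E.target := by
    simp [hE, hψ, hφ, hn₀]
  have h1 : MDifferentiableAt 𝓘(ℂ) 𝓘(ℂ) (φ.symm ∘ E.symm ∘ ψ) n₀ := by
    refine MDifferentiableAt.comp n₀ (mdifferentiableAt_atlas_symm hφa ?_)
      (MDifferentiableAt.comp n₀ ?_ (mdifferentiableAt_atlas hψa (mem_chart_source ℂ n₀)))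
    · simp [hE, hψ, hφ]
    · exact (hEs.differentiableAt (E.open_target.mem_nhds hn₀E)).mdifferentiableAt
  refine h1.congr_of_eventuallyEq ?_
  have hcont : ContinuousAt e.symm n₀ := e.continuousAt_symm hn₀
  filter_upwards [ψ.open_source.mem_nhds (mem_chart_source ℂ n₀),
    hcont.preimage_mem_nhds (φ.open_source.mem_nhds (mem_chart_source ℂ _))] with n h2 h3
  have h3 : e.symm n ∈ φ.source := h3
  simp [hE, h2, h3]

/-- Near x, σ is the composite of q ∘ σ with a holomorphic local inverse of q. Applied to the
covering map, this makes deck transformations holomorphic. -/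
theorem mdifferentiableAt_of_comp_isLocalHomeomorph {q : M → N} (hq : IsLocalHomeomorph q)
    (hqd : MDifferentiable 𝓘(ℂ) 𝓘(ℂ) q) {σ : X → M} {x : X} (hσ : ContinuousAt σ x)
    (h : MDifferentiableAt 𝓘(ℂ) 𝓘(ℂ) (q ∘ σ) x) : MDifferentiableAt 𝓘(ℂ) 𝓘(ℂ) σ x := by
  obtain ⟨e, hx, rfl⟩ := hq (σ x)
  have h1 := (mdifferentiableAt_symm_of_mdifferentiable hqd (e.map_source hx)).comp x h
  refine h1.congr_of_eventuallyEq ?_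
  filter_upwards [hσ.preimage_mem_nhds (e.open_source.mem_nhds hx)] with y hy
  exact (e.left_inv hy).symm

theorem apply_eq_of_mfderiv_eq_zero [PreconnectedSpace M] {g : M → ℂ}
    (hg : MDifferentiable 𝓘(ℂ) 𝓘(ℂ) g) (h : ∀ z, mfderiv 𝓘(ℂ) 𝓘(ℂ) g z = 0) (x y : M) :
    g x = g y := by
  have : IsManifold 𝓘(ℂ) 1 M := .of_le (n := ω) le_top
  suffices IsLocallyConstant g from this.apply_eq_of_preconnectedSpace x y
  rw [IsLocallyConstant.iff_eventually_eq]
  intro x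
  set φ := chartAt ℂ x with hφ
  have hφa : φ ∈ atlas ℂ M := chart_mem_atlas ℂ _
  have hx : x ∈ φ.source := mem_chart_source ℂ x
  obtain ⟨ε, hε, hball⟩ := Metric.isOpen_iff.1 φ.open_target _ (φ.map_source hx)
  have hder : ∀ w ∈ φ.target, HasFDerivAt (g ∘ φ.symm) (0 : ℂ →L[ℂ] ℂ) w := by
    intro w hw
    have h1 := mdifferentiableAt_atlas_symm (I := 𝓘(ℂ)) hφa hw
    have h2 := (hg _).comp w h1
    have h3 := mfderiv_comp w (hg _) h1
    rw [h, ContinuousLinearMap.zero_comp, mfderiv_eq_fderiv] at h3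
    have h4 := (mdifferentiableAt_iff_differentiableAt.1 h2).hasFDerivAt
    rwa [h3] at h4
  filter_upwards [φ.open_source.mem_nhds hx,
    (φ.continuousAt hx).preimage_mem_nhds (Metric.ball_mem_nhds _ hε)] with y hy hy'
  have := Metric.isOpen_ball.is_const_of_fderiv_eq_zero (𝕜 := ℂ)
    (convex_ball (φ x) ε).isPreconnected
    (fun w hw => (hder w (hball hw)).differentiableAt.differentiableWithinAt)
    (fun w hw => (hder w (hball hw)).fderiv) hy' (Metric.mem_ball_self hε)
  simpa [hy, hx] using this

end Manifold

/-! ## Deck transformations -/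

section Deck

variable {C Ct : Type*} [TopologicalSpace C] [ChartedSpace ℂ C]
  [TopologicalSpace Ct] [ChartedSpace ℂ Ct]

/-- The universal cover is Galois: lift p through itself, once sending z to z' and once back. The
two composites lift p and fix a point, hence are the identity by uniqueness of lifts. -/
theorem UniversalCover.exists_deck (U : UniversalCover C Ct) {z z' : Ct} (h : U.p z = U.p z') :
    ∃ γ ∈ U.deckGroup, γ z = z' := by
  have := U.simplyConnected
  have : LocallyPathConnectedSpace Ct := ChartedSpace.locallyPathConnectedSpace ℂ Ct
  have cov := U.isCoveringMap
  let P : C(Ct, C) := ⟨U.p, cov.continuous⟩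
  obtain ⟨F, ⟨hF, hpF⟩, -⟩ := cov.existsUnique_continuousMap_lifts P z z' h.symm
  obtain ⟨G, ⟨hG, hpG⟩, -⟩ := cov.existsUnique_continuousMap_lifts P z' z h
  have hF' : ∀ x, U.p (F x) = U.p x := congrFun hpF
  have hG' : ∀ x, U.p (G x) = U.p x := congrFun hpG
  have hGF : (G ∘ F : Ct → Ct) = id := cov.eq_of_comp_eq (by fun_prop) continuous_id
    (funext fun x => by simp [hF', hG']) z (by simp [hF, hG])
  have hFG : (F ∘ G : Ct → Ct) = id := cov.eq_of_comp_eq (by fun_prop) continuous_id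
    (funext fun x => by simp [hF', hG']) z' (by simp [hF, hG])
  exact ⟨⟨⟨F, G, congrFun hGF, congrFun hFG⟩, F.continuous, G.continuous⟩, hF', hF⟩

theorem UniversalCover.mdifferentiable_deck [IsManifold 𝓘(ℂ) ω C] [IsManifold 𝓘(ℂ) ω Ct]
    (U : UniversalCover C Ct) {γ : Ct ≃ₜ Ct} (hγ : γ ∈ U.deckGroup) :
    MDifferentiable 𝓘(ℂ) 𝓘(ℂ) γ := by
  intro z
  refine mdifferentiableAt_of_comp_isLocalHomeomorph U.isCoveringMap.isLocalHomeomorph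
    U.mdifferentiable γ.continuous.continuousAt ?_
  rw [show U.p ∘ γ = U.p from funext hγ]
  exact U.mdifferentiable z

end Deck

section Monodromy

variable {C Cbar Ct : Type*} [TopologicalSpace C] [ChartedSpace ℂ C]
  [TopologicalSpace Cbar] [ChartedSpace ℂ Cbar] [TopologicalSpace Ct] [ChartedSpace ℂ Ct]
  {K : Compactification C Cbar} {φ : PunctureDiscs K} {U : UniversalCover C Ct}

/-- The local monodromy at a puncture: translation by `1` on the half-plane is induced by a deck
transformation. -/
theorem LiftedDiscs.exists_monodromy (L : LiftedDiscs φ U) (s : K.punctures) (x : φ.lifts U s) :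
    ∃ γ ∈ U.deckGroup, ∀ u ∈ halfPlane, γ (L.φt s x u) = L.φt s x (u + 1) := by
  have h0 : (0 : ℂ) ∈ halfPlane := by simp [halfPlane]
  have key : ∀ u ∈ halfPlane, U.p (L.φt s x u) = U.p (L.φt s x (u + 1)) := by
    intro u hu
    apply K.isOpenEmbedding.injective
    rw [L.lift s x u hu, L.lift s x _ (add_one_mem_halfPlane hu), expMap_add_one]
  obtain ⟨γ, hγ, hγ0⟩ := U.exists_deck (key 0 h0)
  refine ⟨γ, hγ, ?_⟩
  have hpre : IsPreconnected halfPlane := (convex_halfSpace_im_ge 0).isPreconnected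
  -- Both sides lift the same map on the connected half-plane and agree at 0, where γ was chosen.
  refine U.isCoveringMap.eqOn_of_comp_eqOn (g₁ := fun u => γ (L.φt s x u))
    (g₂ := fun u => L.φt s x (u + 1)) hpre
    (γ.continuous.comp_continuousOn (L.hol s x).1)
    ((L.hol s x).1.comp (by fun_prop) fun u hu => add_one_mem_halfPlane hu) ?_ h0 hγ0
  intro u hu
  exact (hγ _).trans (key u hu)

end Monodromy

/-! ## Functions killed by products of operators `γ - 1`, and finite determination -/

section Nilpotent

variable {C Ct : Type*} [TopologicalSpace C] [ChartedSpace ℂ C]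
  [TopologicalSpace Ct] [ChartedSpace ℂ Ct] {U : UniversalCover C Ct}

/-- `f` is killed by all products of `k` operators `γ - 1`, `γ` a deck transformation. -/
def KilledBy (U : UniversalCover C Ct) (k : ℕ) (f : Ct → ℂ) : Prop :=
  ∀ l : List (Ct ≃ₜ Ct), l.length = k → (∀ γ ∈ l, γ ∈ U.deckGroup) →
    l.foldl (fun g γ => diffOp γ g) f = 0

theorem killedBy_zero_iff {f : Ct → ℂ} : KilledBy U 0 f ↔ f = 0 := by
  constructor
  · intro h
    exact h [] rfl (by simp)
  · rintro rfl l hl -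
    rw [List.length_eq_zero_iff.1 hl]
    rfl

/-- The head of the list acts first in `foldl`; this recursion drives all the inductions below. -/
theorem killedBy_succ_iff {k : ℕ} {f : Ct → ℂ} :
    KilledBy U (k + 1) f ↔ ∀ γ ∈ U.deckGroup, KilledBy U k (diffOp γ f) := by
  constructor
  · intro h γ hγ l hl hl'
    exact h (γ :: l) (by simp [hl]) (by simpa [hγ] using hl')
  · intro h l hl hl'
    obtain _ | ⟨γ, l⟩ := l
    · simp at hl
    · exact h γ (hl' γ (by simp)) l (by simpa using hl) fun δ hδ => hl' δ (by simp [hδ])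

theorem diffOp_zero {X : Type*} [TopologicalSpace X] (γ : X ≃ₜ X) :
    diffOp γ (0 : X → ℂ) = 0 := by
  funext z; simp [diffOp]

theorem KilledBy.succ {k : ℕ} : ∀ {f : Ct → ℂ}, KilledBy U k f → KilledBy U (k + 1) f := by
  induction k with
  | zero =>
    intro f h
    rw [killedBy_zero_iff] at h
    rw [killedBy_succ_iff]
    intro γ _
    rw [h, diffOp_zero, killedBy_zero_iff]
  | succ k ih =>
    intro f h
    rw [killedBy_succ_iff] at h ⊢
    exact fun γ hγ => ih (h γ hγ)

theorem KilledBy.mono {k l : ℕ} (hkl : k ≤ l) {f : Ct → ℂ} (h : KilledBy U k f) :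
    KilledBy U l f := by
  induction hkl with
  | refl => exact h
  | step _ ih => exact ih.succ

/-- Applying γ - 1 to f ∘ δ gives the composite with δ of the function obtained from f by δγδ⁻¹ - 1.
-/
theorem KilledBy.comp_deck {k : ℕ} {δ : Ct ≃ₜ Ct} (hδ : δ ∈ U.deckGroup) :
    ∀ {f : Ct → ℂ}, KilledBy U k f → KilledBy U k (f ∘ δ) := by
  induction k with
  | zero =>
    intro f h
    rw [killedBy_zero_iff] at h ⊢
    rw [h]; rfl
  | succ k ih =>
    intro f h
    rw [killedBy_succ_iff] at h ⊢
    intro γ hγ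
    have h1 := ih (h (δ * γ * δ⁻¹) (mul_mem (mul_mem hδ hγ) (inv_mem hδ)))
    convert h1 using 1
    funext z
    have : δ⁻¹ (δ z) = z := δ.symm_apply_apply z
    change f (δ (γ z)) - f (δ z) = f (δ (γ (δ⁻¹ (δ z)))) - f (δ z)
    rw [this]

theorem KilledBy.add {k : ℕ} : ∀ {f g : Ct → ℂ}, KilledBy U k f → KilledBy U k g →
    KilledBy U k (f + g) := by
  induction k with
  | zero =>
    intro f g hf hg
    rw [killedBy_zero_iff] at *
    rw [hf, hg, add_zero]
  | succ k ih =>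
    intro f g hf hg
    rw [killedBy_succ_iff] at *
    intro γ hγ
    have := ih (hf γ hγ) (hg γ hγ)
    convert this using 1
    funext z
    simp only [diffOp, Pi.add_apply]; ring

/-- Twisted Leibniz rule: γ - 1 sends fg to ((γ - 1)f)(g ∘ γ) + f((γ - 1)g). Each term lowers one of
the two indices, whence the double induction. -/
theorem KilledBy.mul {k : ℕ} : ∀ {l : ℕ} {f g : Ct → ℂ}, KilledBy U k f → KilledBy U l g →
    KilledBy U (k + l) (f * g) := by
  induction k with
  | zero =>
    intro l f g hf hg
    rw [killedBy_zero_iff] at hf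
    rw [hf, zero_mul]
    exact KilledBy.mono (Nat.zero_le _) (killedBy_zero_iff.2 rfl)
  | succ k ihk =>
    intro l
    induction l with
    | zero =>
      intro f g hf hg
      rw [killedBy_zero_iff] at hg
      rw [hg, mul_zero]
      exact KilledBy.mono (Nat.zero_le _) (killedBy_zero_iff.2 rfl)
    | succ l ihl =>
      intro f g hf hg
      rw [← add_assoc, killedBy_succ_iff]
      intro γ hγ
      have h1 := ihk (killedBy_succ_iff.1 hf γ hγ) (hg.comp_deck hγ)
      have h2 := ihl hf (killedBy_succ_iff.1 hg γ hγ)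
      have h3 := (h1.mono (by omega : k + (l + 1) ≤ k + 1 + l)).add h2
      convert h3 using 1
      funext z
      simp only [diffOp, Pi.add_apply, Pi.mul_apply, Function.comp_apply]; ring

theorem killedBy_one_of_const {f : Ct → ℂ} (h : ∀ z w, f z = f w) : KilledBy U 1 f := by
  rw [killedBy_succ_iff]
  intro γ _
  rw [killedBy_zero_iff]
  funext z
  simp [diffOp, h (γ z) z]

theorem FiniteDetermination.of_le {f : Ct → ℂ} {V : Submodule ℂ (Ct → ℂ)} (hV : V.FG)
    (h : ∀ γ ∈ U.deckGroup, f ∘ γ ∈ V) : FiniteDetermination U f := by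
  refine Submodule.FG.of_le hV (Submodule.span_le.2 ?_)
  rintro _ ⟨γ, rfl⟩
  exact h _ γ.2

/-- The span of the branches of `f`. -/
def branchSpan (U : UniversalCover C Ct) (f : Ct → ℂ) : Submodule ℂ (Ct → ℂ) :=
  Submodule.span ℂ (Set.range fun γ : U.deckGroup => f ∘ (γ : Ct ≃ₜ Ct))

theorem comp_mem_branchSpan (f : Ct → ℂ) {γ : Ct ≃ₜ Ct} (hγ : γ ∈ U.deckGroup) :
    f ∘ γ ∈ branchSpan U f :=
  Submodule.subset_span ⟨⟨γ, hγ⟩, rfl⟩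

theorem FiniteDetermination.add {f g : Ct → ℂ} (hf : FiniteDetermination U f)
    (hg : FiniteDetermination U g) : FiniteDetermination U (f + g) :=
  .of_le (V := branchSpan U f ⊔ branchSpan U g) (Submodule.FG.sup hf hg) fun _ hγ =>
    Submodule.add_mem_sup (comp_mem_branchSpan f hγ) (comp_mem_branchSpan g hγ)

theorem FiniteDetermination.mul {f g : Ct → ℂ} (hf : FiniteDetermination U f)
    (hg : FiniteDetermination U g) : FiniteDetermination U (f * g) :=
  .of_le (V := branchSpan U f * branchSpan U g) (Submodule.FG.mul hf hg) fun _ hγ =>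
    Submodule.mul_mem_mul (comp_mem_branchSpan f hγ) (comp_mem_branchSpan g hγ)

theorem finiteDetermination_const (c : ℂ) : FiniteDetermination U (fun _ : Ct => c) :=
  .of_le (V := Submodule.span ℂ {fun _ => c}) (Submodule.fg_span_singleton _) fun _ _ =>
    Submodule.mem_span_singleton_self _

end Nilpotent

/-! ## Primitives of differentials on the universal cover -/

theorem kaehler_induction {A : Type*} [CommRing A] [Algebra ℂ A] {P : Ω[A⁄ℂ] → Prop}
    (hD : ∀ a, P (KaehlerDifferential.D ℂ A a)) (hadd : ∀ η θ, P η → P θ → P (η + θ))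
    (hsmul : ∀ (a : A) η, P η → P (a • η)) (η : Ω[A⁄ℂ]) : P η := by
  have hη : η ∈ Submodule.span A (Set.range (KaehlerDifferential.D ℂ A)) := by
    rw [KaehlerDifferential.span_range_derivation]; trivial
  induction hη using Submodule.span_induction with
  | mem x hx =>
    obtain ⟨a, rfl⟩ := hx
    exact hD a
  | zero => simpa using hD 0
  | add x y _ _ hx hy => exact hadd x y hx hy
  | smul a x _ hx => exact hsmul a x hx

section Primitive

variable {A C Ct : Type*} [CommRing A] [Algebra ℂ A]
  [TopologicalSpace C] [ChartedSpace ℂ C] [TopologicalSpace Ct] [ChartedSpace ℂ Ct]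
  (an : Analytification A C) (U : UniversalCover C Ct)

theorem pullbackDifferential_D (a : A) (z : Ct) :
    pullbackDifferential an U (KaehlerDifferential.D ℂ A a) z =
      mfderiv 𝓘(ℂ) 𝓘(ℂ) (fun z => an.pt (U.p z) a) z := by
  unfold pullbackDifferential pullbackForm
  rw [Derivation.liftKaehlerDifferential_comp_D]
  rfl

theorem pullbackDifferential_add (η θ : Ω[A⁄ℂ]) (z : Ct) :
    pullbackDifferential an U (η + θ) z =
      pullbackDifferential an U η z + pullbackDifferential an U θ z := by
  unfold pullbackDifferential
  rw [map_add]
  rfl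

theorem pullbackDifferential_smul (a : A) (η : Ω[A⁄ℂ]) (z : Ct) :
    pullbackDifferential an U (a • η) z =
      an.pt (U.p z) a • pullbackDifferential an U η z := by
  unfold pullbackDifferential
  rw [map_smul, formsOver_smul_apply]

theorem mdifferentiable_regular (a : A) :
    MDifferentiable 𝓘(ℂ) 𝓘(ℂ) (fun z => an.pt (U.p z) a) :=
  (an.mdifferentiable a).comp U.mdifferentiable

/-- `g` is holomorphic and `dg = f · p^*η`. -/
def IsPrimitive (f : Ct → ℂ) (η : Ω[A⁄ℂ]) (g : Ct → ℂ) : Prop :=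
  MDifferentiable 𝓘(ℂ) 𝓘(ℂ) g ∧
    ∀ z, mfderiv 𝓘(ℂ) 𝓘(ℂ) g z = f z • pullbackDifferential an U η z

variable {an U}

theorem IsPrimitive.add {f f' g g' : Ct → ℂ} {η : Ω[A⁄ℂ]} (h : IsPrimitive an U f η g)
    (h' : IsPrimitive an U f' η g') : IsPrimitive an U (f + f') η (g + g') := by
  refine ⟨h.1.add h'.1, fun z => ?_⟩
  rw [mfderiv_add (h.1 z) (h'.1 z), h.2, h'.2, Pi.add_apply]
  exact (add_smul _ _ (pullbackDifferential an U η z : ℂ →L[ℂ] ℂ)).symm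

theorem IsPrimitive.const_smul {f g : Ct → ℂ} {η : Ω[A⁄ℂ]} (c : ℂ)
    (h : IsPrimitive an U f η g) : IsPrimitive an U (c • f) η (c • g) := by
  refine ⟨h.1.const_smul c, fun z => ?_⟩
  rw [const_smul_mfderiv (h.1 z) c, h.2, Pi.smul_apply, smul_eq_mul]
  exact (mul_smul _ _ (pullbackDifferential an U η z : ℂ →L[ℂ] ℂ)).symm

variable [IsManifold 𝓘(ℂ) ω Ct]

theorem IsPrimitive.apply_eq {g : Ct → ℂ} {η : Ω[A⁄ℂ]} (h : IsPrimitive an U 0 η g) (z w : Ct) :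
    g z = g w := by
  have := U.simplyConnected
  refine apply_eq_of_mfderiv_eq_zero h.1 (fun z => ?_) z w
  rw [h.2]
  exact zero_smul ℂ (pullbackDifferential an U η z : ℂ →L[ℂ] ℂ)

variable [IsManifold 𝓘(ℂ) ω C]

/-- Invariance of p^*η follows from p ∘ γ = p: the chain rule gives it for exact forms, and the
coefficients are invariant too. -/
theorem pullbackDifferential_comp_deck {γ : Ct ≃ₜ Ct} (hγ : γ ∈ U.deckGroup) (η : Ω[A⁄ℂ])
    (z : Ct) (v : TangentSpace 𝓘(ℂ) z) :
    pullbackDifferential an U η (γ z) (mfderiv 𝓘(ℂ) 𝓘(ℂ) γ z v) =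
      pullbackDifferential an U η z v := by
  induction η using kaehler_induction with
  | hD a =>
    rw [pullbackDifferential_D, pullbackDifferential_D]
    refine (mfderiv_comp_apply z (mdifferentiable_regular an U a _)
      (U.mdifferentiable_deck hγ z) v).symm.trans ?_
    rw [show (fun z => an.pt (U.p z) a) ∘ γ = fun z => an.pt (U.p z) a from
      funext fun w => by simp [hγ w]]
    rfl
  | hadd η θ h1 h2 =>
    rw [pullbackDifferential_add, pullbackDifferential_add]
    exact congrArg₂ (· + ·) h1 h2
  | hsmul a η h =>
    rw [pullbackDifferential_smul, pullbackDifferential_smul, hγ z]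
    exact congrArg (an.pt (U.p z) a * ·) h

theorem IsPrimitive.comp_deck {f g : Ct → ℂ} {η : Ω[A⁄ℂ]} (h : IsPrimitive an U f η g)
    {γ : Ct ≃ₜ Ct} (hγ : γ ∈ U.deckGroup) : IsPrimitive an U (f ∘ γ) η (g ∘ γ) := by
  refine ⟨h.1.comp (U.mdifferentiable_deck hγ), fun z => ContinuousLinearMap.ext fun v => ?_⟩
  refine (mfderiv_comp_apply z (h.1 _) (U.mdifferentiable_deck hγ z) v).trans ?_
  rw [h.2]
  exact congrArg (f (γ z) * ·) (pullbackDifferential_comp_deck hγ η z v)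

theorem IsPrimitive.diffOp {f g : Ct → ℂ} {η : Ω[A⁄ℂ]} (h : IsPrimitive an U f η g)
    {γ : Ct ≃ₜ Ct} (hγ : γ ∈ U.deckGroup) : IsPrimitive an U (diffOp γ f) η (diffOp γ g) := by
  have := (h.comp_deck hγ).add (h.const_smul (-1))
  convert this using 1 <;>
  · funext z
    simp [NilssonCurve.diffOp, sub_eq_add_neg]

/-- Since γ - 1 carries primitives to primitives, induction reduces to f = 0. There g is constant,
which accounts for the one extra operator. -/
theorem IsPrimitive.killedBy {k : ℕ} {η : Ω[A⁄ℂ]} : ∀ {f g : Ct → ℂ},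
    IsPrimitive an U f η g → KilledBy U k f → KilledBy U (k + 1) g := by
  induction k with
  | zero =>
    intro f g h hf
    rw [killedBy_zero_iff] at hf
    subst hf
    exact killedBy_one_of_const h.apply_eq
  | succ k ih =>
    intro f g h hf
    rw [killedBy_succ_iff] at hf ⊢
    exact fun γ hγ => ih (h.diffOp hγ) (hf γ hγ)

theorem IsPrimitive.finiteDetermination {f g : Ct → ℂ} {η : Ω[A⁄ℂ]}
    (h : IsPrimitive an U f η g) (hf : FiniteDetermination U f) : FiniteDetermination U g := by
  -- Pairs (primitive, integrand) with integrand in the span of the branches of f. The second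
  -- projection has finite-dimensional image, and its kernel consists of constants, so the space is
  -- finite-dimensional; its first projection contains every branch of g.
  let P : Submodule ℂ ((Ct → ℂ) × (Ct → ℂ)) :=
    { carrier := {x | x.2 ∈ branchSpan U f ∧ IsPrimitive an U x.2 η x.1}
      add_mem' := fun hx hy => ⟨add_mem hx.1 hy.1, hx.2.add hy.2⟩
      zero_mem' := by
        refine ⟨zero_mem _, ?_⟩
        simpa using h.const_smul 0
      smul_mem' := fun c x hx => ⟨Submodule.smul_mem _ c hx.1, hx.2.const_smul c⟩ }
  have hP : P.FG := by
    refine Submodule.fg_of_fg_map_of_fg_inf_ker (LinearMap.snd ℂ _ _) ?_ ?_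
    · refine Submodule.FG.of_le (T := branchSpan U f) hf ?_
      rintro _ ⟨x, hx, rfl⟩
      exact hx.1
    · refine Submodule.FG.of_le (T := Submodule.span ℂ {((fun _ => 1), 0)})
        (Submodule.fg_span_singleton _) ?_
      rintro ⟨x, y⟩ ⟨hx, hy⟩
      have hy : y = 0 := hy
      subst hy
      rw [Submodule.mem_span_singleton]
      rcases isEmpty_or_nonempty Ct with hE | ⟨⟨z₀⟩⟩
      · exact ⟨0, Prod.ext (funext fun z => hE.elim z) (by simp)⟩
      · refine ⟨x z₀, Prod.ext (funext fun z => ?_) (by simp)⟩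
        simpa using IsPrimitive.apply_eq hx.2 z₀ z
  refine .of_le (V := P.map (LinearMap.fst ℂ _ _)) (hP.map _) fun γ hγ => ?_
  exact ⟨(g ∘ γ, f ∘ γ), ⟨comp_mem_branchSpan f hγ, h.comp_deck hγ⟩, rfl⟩

end Primitive

/-! ## Growth at the punctures -/

/-- A holomorphic function on the half-plane whose derivative has moderate growth near infinity
has moderate growth. -/
theorem moderateOnHalfPlane_of_deriv {G : ℂ → ℂ} (hG : HolOn halfPlane G) (n : ℕ) {y₀ : ℝ}
    (hy₀ : 0 ≤ y₀) (h : ∀ a b : ℝ, ∃ K : ℝ, 0 ≤ K ∧ ∀ u : ℂ, a ≤ u.re → u.re ≤ b → y₀ < u.im →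
      ‖deriv G u‖ ≤ K * Real.exp (2 * Real.pi * n * u.im)) :
    ModerateOnHalfPlane G := by
  rw [moderateOnHalfPlane_iff]
  refine ⟨hG, n + 1, fun a b => ?_⟩
  obtain ⟨K, hK, hb⟩ := h a b
  -- Compactness bounds G up to height y₀ + 1. Above it, the mean value inequality is applied from
  -- the point v at that height, where the derivative bound, valid only strictly above y₀, is
  -- available. The length of the segment is absorbed by raising n to n + 1.
  have hcomp : IsCompact (Set.Icc a b ×ℂ Set.Icc 0 (y₀ + 1)) := isCompact_Icc.reProdIm isCompact_Icc
  obtain ⟨M, hM⟩ := hcomp.exists_bound_of_continuousOn (hG.1.mono fun u hu => hu.2.1)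
  have hp := Real.pi_pos
  have hbd : ∀ u : ℂ, a ≤ u.re → u.re ≤ b → 0 ≤ u.im → u.im ≤ y₀ + 1 → ‖G u‖ ≤ |M| :=
    fun u h1 h2 h3 h4 => (hM u ⟨⟨h1, h2⟩, h3, h4⟩).trans (le_abs_self M)
  refine ⟨|M| + K, by positivity, fun u h1 h2 h3 => ?_⟩
  have hexp : 1 ≤ Real.exp (2 * Real.pi * (n + 1 : ℕ) * u.im) := Real.one_le_exp (by positivity)
  have hMexp := le_mul_of_one_le_right (abs_nonneg M) hexp
  rw [add_mul]
  by_cases h4 : u.im ≤ y₀ + 1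
  · exact (hbd u h1 h2 h3 h4).trans (hMexp.trans (le_add_of_nonneg_right (by positivity)))
  · push Not at h4
    set v : ℂ := ⟨u.re, y₀ + 1⟩ with hv
    have hconv : Convex ℝ (Set.Icc a b ×ℂ Set.Icc (y₀ + 1) u.im) :=
      ((convex_Icc a b).linear_preimage Complex.reLm).inter
        ((convex_Icc (y₀ + 1) u.im).linear_preimage Complex.imLm)
    have hdiff := hconv.norm_image_sub_le_of_norm_deriv_le (f := G) (x := v) (y := u)
      (C := K * Real.exp (2 * Real.pi * n * u.im))
      (fun w hw => hG.2.differentiableAt (isOpen_interior.mem_nhds (by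
        rw [interior_halfPlane]
        exact lt_of_lt_of_le (by linarith) hw.2.1)))
      (fun w hw => (hb w hw.1.1 hw.1.2 (lt_of_lt_of_le (by linarith) hw.2.1)).trans (by
        have := hw.2.2
        gcongr)) ⟨⟨h1, h2⟩, le_rfl, h4.le⟩ ⟨⟨h1, h2⟩, h4.le, le_rfl⟩
    have huv : ‖u - v‖ ≤ Real.exp (2 * Real.pi * u.im) := by
      have e1 : u - v = ((u.im - (y₀ + 1) : ℝ) : ℂ) * Complex.I := by
        apply Complex.ext <;> simp [hv]
      rw [e1, norm_mul, Complex.norm_I, mul_one, Complex.norm_real, Real.norm_eq_abs,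
        abs_of_pos (by linarith)]
      have := Real.add_one_le_exp (2 * Real.pi * u.im)
      have := Real.pi_gt_three
      nlinarith
    have hGv := hbd v h1 h2 (by simp only [hv]; linarith) le_rfl
    have e2 : Real.exp (2 * Real.pi * (n + 1 : ℕ) * u.im) =
        Real.exp (2 * Real.pi * n * u.im) * Real.exp (2 * Real.pi * u.im) := by
      rw [← Real.exp_add]; push_cast; ring_nf
    calc ‖G u‖ = ‖G v + (G u - G v)‖ := by ring_nf
      _ ≤ ‖G v‖ + ‖G u - G v‖ := norm_add_le _ _
      _ ≤ |M| * Real.exp (2 * Real.pi * (n + 1 : ℕ) * u.im) +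
          K * Real.exp (2 * Real.pi * (n + 1 : ℕ) * u.im) := by
        refine add_le_add (hGv.trans hMexp) (hdiff.trans ?_)
        rw [e2, ← mul_assoc]
        gcongr

section Growth

variable {C Cbar Ct : Type*} [TopologicalSpace C] [ChartedSpace ℂ C]
  [TopologicalSpace Cbar] [ChartedSpace ℂ Cbar] [TopologicalSpace Ct] [ChartedSpace ℂ Ct]
  {K : Compactification C Cbar} {φ : PunctureDiscs K} {U : UniversalCover C Ct}

theorem PunctureDiscs.mem_range (φ : PunctureDiscs K) (s : K.punctures) {z : ℂ}
    (hz : z ∈ puncturedDisc) : φ.φ s z ∈ Set.range K.ι := by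
  by_contra h
  have h1 : φ.φ s z ∈ φ.φ s '' disc ∩ K.punctures := ⟨⟨z, hz.1, rfl⟩, h⟩
  rw [φ.inter s, Set.mem_singleton_iff, ← φ.map_zero s] at h1
  exact hz.2 (φ.injOn s hz.1 (by simp [disc]) h1)

/-- A regular function on an affine curve has at most a pole at each puncture. -/
theorem exists_pole_bound_regular {A : Type*} [CommRing A] [IsDomain A] [Algebra ℂ A]
    [IsNoetherianRing A] (hdim : ringKrullDim A = 1)
    [IsManifold 𝓘(ℂ) ω C] [IsManifold 𝓘(ℂ) ω Cbar] (an : Analytification A C)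
    (φ : PunctureDiscs K) (s : K.punctures) (a : A) :
    ∃ (m : ℕ) (B r : ℝ), 0 < r ∧ ∀ (z : ℂ) (c : C), z ∈ puncturedDisc → ‖z‖ < r →
      K.ι c = φ.φ s z → ‖z ^ m * an.pt c a‖ ≤ B := by
  rcases isEmpty_or_nonempty C with hC | hC
  · exact ⟨0, 0, 1, one_pos, fun _ c => hC.elim c⟩
  -- Constants are set aside because their fibres are not finite.
  by_cases ha : ∃ c, a = algebraMap ℂ A c
  · obtain ⟨c, rfl⟩ := ha
    exact ⟨0, ‖c‖, 1, one_pos, fun z c' _ _ _ => by simp⟩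
  push Not at ha
  let e := K.isOpenEmbedding.toOpenPartialHomeomorph K.ι
  have hball : Metric.ball (0 : ℂ) 1 \ {0} ⊆ puncturedDisc := by
    rw [← interior_puncturedDisc]; exact interior_subset
  have htarget : ∀ z ∈ puncturedDisc, φ.φ s z ∈ e.target := fun z hz => by
    simpa [e] using φ.mem_range s hz
  have hd : DifferentiableOn ℂ (fun z => an.pt (e.symm (φ.φ s z)) a) (Metric.ball 0 1 \ {0}) := by
    intro z hz
    refine DifferentiableAt.differentiableWithinAt ?_
    rw [← mdifferentiableAt_iff_differentiableAt]
    have h1 : MDifferentiableAt 𝓘(ℂ) 𝓘(ℂ) (φ.φ s) z := by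
      refine ((φ.hol s).2 z ?_).mdifferentiableAt (isOpen_interior.mem_nhds ?_) <;>
      · rw [interior_disc]; exact hz.1
    have h2 : MDifferentiableAt 𝓘(ℂ) 𝓘(ℂ) e.symm (φ.φ s z) :=
      mdifferentiableAt_symm_of_mdifferentiable (e := e) K.mdifferentiable (htarget z (hball hz))
    exact MDifferentiableAt.comp (f := e.symm ∘ φ.φ s) (g := fun c => an.pt c a) z
      (an.mdifferentiable a _) (h2.comp z h1)
  have hinj : Set.InjOn (fun z => an.pt (e.symm (φ.φ s z))) puncturedDisc := by
    intro z hz w hw h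
    exact φ.injOn s hz.1 hw.1 (e.symm.injOn (htarget z hz) (htarget w hw) (an.bijective.1 h))
  -- The punctured disc injects into the characters of A, so a fibre on the disc embeds into a
  -- finite fibre of a.
  obtain ⟨m, B, r, hr, hB⟩ := exists_pole_bound hd fun c => by
    refine Set.Finite.of_finite_image
      ((finite_setOf_algHom_apply_eq hdim (ha c)).subset ?_) (hinj.mono fun z hz => hball hz.1)
    rintro _ ⟨z, hz, rfl⟩
    exact hz.2
  refine ⟨m, B, r, hr, fun z c hz hzr hc => ?_⟩
  have h3 : e.symm (φ.φ s z) = c := by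
    rw [← hc]
    exact e.left_inv (by simp [e])
  simpa only [h3] using hB z hz.2 hzr

variable (L : LiftedDiscs φ U) (s : K.punctures) (x : φ.lifts U s)

theorem LiftedDiscs.mdifferentiableAt {u : ℂ} (hu : 0 < u.im) :
    MDifferentiableAt 𝓘(ℂ) 𝓘(ℂ) (L.φt s x) u := by
  have h : u ∈ interior halfPlane := by rwa [interior_halfPlane]
  exact ((L.hol s x).2 u h).mdifferentiableAt (isOpen_interior.mem_nhds h)

theorem LiftedDiscs.differentiableAt_comp {h : Ct → ℂ} (hh : MDifferentiable 𝓘(ℂ) 𝓘(ℂ) h) {u : ℂ}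
    (hu : 0 < u.im) : DifferentiableAt ℂ (h ∘ L.φt s x) u :=
  mdifferentiableAt_iff_differentiableAt.1 ((hh _).comp u (L.mdifferentiableAt s x hu))

theorem LiftedDiscs.holOn_comp {h : Ct → ℂ} (hh : MDifferentiable 𝓘(ℂ) 𝓘(ℂ) h) :
    HolOn halfPlane (h ∘ L.φt s x) := by
  refine ⟨hh.continuous.comp_continuousOn (L.hol s x).1, fun u hu => ?_⟩
  rw [interior_halfPlane] at hu
  exact (L.differentiableAt_comp s x hh hu).differentiableWithinAt

/-- The velocity of the lifted disc. -/
def LiftedDiscs.velocity (u : ℂ) : TangentSpace 𝓘(ℂ) (L.φt s x u) :=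
  mfderiv 𝓘(ℂ) 𝓘(ℂ) (L.φt s x) u (1 : ℂ)

theorem LiftedDiscs.deriv_comp {h : Ct → ℂ} (hh : MDifferentiable 𝓘(ℂ) 𝓘(ℂ) h) {u : ℂ}
    (hu : 0 < u.im) : deriv (h ∘ L.φt s x) u =
      mfderiv 𝓘(ℂ) 𝓘(ℂ) h (L.φt s x u) (L.velocity s x u) := by
  have h1 := mfderiv_comp_apply u (hh _) (L.mdifferentiableAt s x hu) (1 : ℂ)
  rw [mfderiv_eq_fderiv] at h1
  exact h1

variable {A : Type*} [CommRing A] [IsDomain A] [Algebra ℂ A] [IsNoetherianRing A]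
  [IsManifold 𝓘(ℂ) ω C] [IsManifold 𝓘(ℂ) ω Cbar]

theorem exists_bound_regular (hdim : ringKrullDim A = 1) (an : Analytification A C) (a : A) :
    ∃ (m : ℕ) (B y₀ : ℝ), 0 ≤ B ∧ 0 ≤ y₀ ∧ ∀ u : ℂ, y₀ < u.im →
      ‖an.pt (U.p (L.φt s x u)) a‖ ≤ B * Real.exp (2 * Real.pi * m * u.im) := by
  obtain ⟨m, B, r, hr, hB⟩ := exists_pole_bound_regular hdim an φ s a
  -- As |e(u)| = exp(-2π im u), a height above |log r| puts e(u) within radius r.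
  refine ⟨m, |B|, |Real.log r|, abs_nonneg _, abs_nonneg _, fun u hu => ?_⟩
  have hu0 : 0 < u.im := (abs_nonneg _).trans_lt hu
  have hu' : u ∈ halfPlane := hu0.le
  have hnorm : ‖expMap u‖ < r := by
    rw [norm_expMap, ← Real.lt_log_iff_exp_lt hr]
    have := neg_abs_le (Real.log r)
    have := Real.pi_gt_three
    nlinarith
  have h1 := (hB _ _ (expMap_mem_puncturedDisc.2 hu') hnorm (L.lift s x u hu')).trans (le_abs_self B)
  rw [norm_mul, norm_pow, norm_expMap, ← Real.exp_nat_mul] at h1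
  have h2 := mul_le_mul_of_nonneg_right h1 (Real.exp_pos (2 * Real.pi * m * u.im)).le
  rwa [mul_right_comm, ← Real.exp_add, show (m : ℝ) * -(2 * Real.pi * u.im) +
    2 * Real.pi * m * u.im = 0 by ring, Real.exp_zero, one_mul] at h2

/-- For an exact form the pairing with the velocity is the derivative of a pulled-back regular
function, bounded by Cauchy's estimate on unit discs; sums and A-multiples preserve such bounds. -/
theorem exists_bound_differential (hdim : ringKrullDim A = 1) (an : Analytification A C)
    (η : Ω[A⁄ℂ]) : ∃ (m : ℕ) (B y₀ : ℝ), 0 ≤ B ∧ 0 ≤ y₀ ∧ ∀ u : ℂ, y₀ < u.im →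
      ‖(pullbackDifferential an U η (L.φt s x u) (L.velocity s x u) : ℂ)‖ ≤
        B * Real.exp (2 * Real.pi * m * u.im) := by
  have hp := Real.pi_pos
  induction η using kaehler_induction with
  | hD a =>
    obtain ⟨m, B, y₀, hB, hy₀, h⟩ := exists_bound_regular L s x hdim an a
    -- The shift by 1 keeps the closed unit disc around u above y₀; the factor exp(2πm) pays for its
    -- points reaching height im u + 1.
    refine ⟨m, B * Real.exp (2 * Real.pi * m), y₀ + 1, by positivity, by positivity, fun u hu => ?_⟩
    have hreg := mdifferentiable_regular an U a
    rw [pullbackDifferential_D]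
    refine (congrArg norm (L.deriv_comp s x hreg (by linarith : 0 < u.im)).symm).trans_le ?_
    have him : ∀ w ∈ Metric.closedBall u 1, y₀ < w.im ∧ w.im ≤ u.im + 1 := by
      intro w hw
      rw [mem_closedBall_iff_norm] at hw
      have := (Complex.abs_im_le_norm (w - u)).trans hw
      rw [Complex.sub_im, abs_le] at this
      constructor <;> linarith
    have hdiff : DiffContOnCl ℂ ((fun z => an.pt (U.p z) a) ∘ L.φt s x) (Metric.ball u 1) := by
      refine DifferentiableOn.diffContOnCl fun w hw => ?_
      rw [closure_ball u one_ne_zero] at hw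
      exact (L.differentiableAt_comp s x hreg (by linarith [him w hw])).differentiableWithinAt
    have := Complex.norm_deriv_le_of_forall_mem_sphere_norm_le one_pos hdiff
      (C := B * Real.exp (2 * Real.pi * m) * Real.exp (2 * Real.pi * m * u.im)) fun w hw => by
        have hw' := him w (Metric.sphere_subset_closedBall hw)
        refine (h w hw'.1).trans ?_
        rw [mul_assoc B, ← Real.exp_add]
        gcongr
        calc 2 * Real.pi * m * w.im ≤ 2 * Real.pi * m * (u.im + 1) := by gcongr; exact hw'.2
          _ = _ := by ring
    simpa using this
  | hadd η θ h1 h2 =>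
    obtain ⟨m, B, y, hB, hy, h1⟩ := h1
    obtain ⟨m', B', y', hB', hy', h2⟩ := h2
    refine ⟨m + m', B + B', max y y', by positivity, le_max_of_le_left hy, fun u hu => ?_⟩
    have hu1 := (le_max_left y y').trans_lt hu
    have hu2 := (le_max_right y y').trans_lt hu
    have hu0 : 0 ≤ u.im := hy.trans hu1.le
    rw [pullbackDifferential_add, add_mul]
    refine (norm_add_le (E := ℂ) _ _).trans (add_le_add ((h1 u hu1).trans ?_) ((h2 u hu2).trans ?_))
      <;> gcongr <;> simp
  | hsmul a η h1 =>
    obtain ⟨m, B, y, hB, hy, h1⟩ := h1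
    obtain ⟨m', B', y', hB', hy', h2⟩ := exists_bound_regular L s x hdim an a
    refine ⟨m' + m, B' * B, max y y', by positivity, le_max_of_le_left hy, fun u hu => ?_⟩
    have hu1 := (le_max_left y y').trans_lt hu
    have hu2 := (le_max_right y y').trans_lt hu
    rw [pullbackDifferential_smul]
    refine (norm_mul (α := ℂ) _ _).trans_le ?_
    refine (mul_le_mul (h2 u hu2) (h1 u hu1) (norm_nonneg _) (by positivity)).trans_eq ?_
    rw [mul_mul_mul_comm, ← Real.exp_add]
    push_cast
    ring_nf

theorem IsPrimitive.moderateOnHalfPlane (hdim : ringKrullDim A = 1) {an : Analytification A C}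
    {f g : Ct → ℂ} {η : Ω[A⁄ℂ]} (h : IsPrimitive an U f η g)
    (hf : ModerateOnHalfPlane (f ∘ L.φt s x)) : ModerateOnHalfPlane (g ∘ L.φt s x) := by
  obtain ⟨-, n, hn⟩ := moderateOnHalfPlane_iff.1 hf
  obtain ⟨m, B, y₀, hB, hy₀, hη⟩ := exists_bound_differential L s x hdim an η
  refine moderateOnHalfPlane_of_deriv (L.holOn_comp s x h.1) (n + m) hy₀ fun a b => ?_
  obtain ⟨M, hM, hn⟩ := hn a b
  refine ⟨M * B, by positivity, fun u h1 h2 h3 => ?_⟩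
  have hu : 0 < u.im := hy₀.trans_lt h3
  rw [L.deriv_comp s x h.1 hu, h.2]
  refine (norm_mul (α := ℂ) _ _).trans_le ?_
  refine (mul_le_mul (hn u h1 h2 hu.le) (hη u h3) (norm_nonneg _) (by positivity)).trans_eq ?_
  rw [mul_mul_mul_comm, ← Real.exp_add]
  push_cast
  ring_nf

end Growth

/-! ## Expansions at the punctures -/

section Expansion

variable {C Cbar Ct : Type*} [TopologicalSpace C] [ChartedSpace ℂ C]
  [TopologicalSpace Cbar] [ChartedSpace ℂ Cbar] [TopologicalSpace Ct] [ChartedSpace ℂ Ct]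
  {K : Compactification C Cbar} {φ : PunctureDiscs K} {U : UniversalCover C Ct}

theorem KilledBy.iterate_eq_zero {γ : Ct ≃ₜ Ct} (hγ : γ ∈ U.deckGroup) {k : ℕ} :
    ∀ {f : Ct → ℂ}, KilledBy U k f → (diffOp γ)^[k] f = 0 := by
  induction k with
  | zero => exact fun h => killedBy_zero_iff.1 h
  | succ k ih => exact fun h => ih (killedBy_succ_iff.1 h γ hγ)

theorem isLogPolynomial_of_killedBy (L : LiftedDiscs φ U) (s : K.punctures) (x : φ.lifts U s)
    {f : Ct → ℂ} {k : ℕ} (hf : f ∈ moderateFun L) (hk : KilledBy U k f) :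
    IsLogPolynomial (f ∘ L.φt s x) := by
  obtain ⟨γ, hγ, hmon⟩ := L.exists_monodromy s x
  refine isLogPolynomial_of_fwdDiff_iterate_eq_zero k _ (hf.2 s x) ?_
  have key : ∀ j : ℕ, ∀ u ∈ halfPlane,
      (fwdDiff 1)^[j] (f ∘ L.φt s x) u = (diffOp γ)^[j] f (L.φt s x u) := by
    intro j
    induction j with
    | zero => exact fun u _ => rfl
    | succ j ih =>
      intro u hu
      rw [Function.iterate_succ_apply', Function.iterate_succ_apply', fwdDiff, ih u hu,
        ih _ (add_one_mem_halfPlane hu), ← hmon u hu]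
      rfl
  intro u hu
  rw [key k u hu, hk.iterate_eq_zero hγ]
  rfl

/-- The algebra of functions of Nilsson class which are unipotent for the group of deck
transformations. -/
def unipotentNilsson (L : LiftedDiscs φ U) : Subalgebra ℂ (Ct → ℂ) where
  carrier := {f | IsNilssonClass L f ∧ ∃ k, KilledBy U k f}
  mul_mem' := by
    rintro f g ⟨⟨⟨hf, hfm⟩, hfd⟩, k, hk⟩ ⟨⟨⟨hg, hgm⟩, hgd⟩, l, hl⟩
    exact ⟨⟨⟨mul_mem hf hg, fun s x => (hfm s x).mul (hgm s x)⟩, hfd.mul hgd⟩, _, hk.mul hl⟩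
  add_mem' := by
    rintro f g ⟨⟨⟨hf, hfm⟩, hfd⟩, k, hk⟩ ⟨⟨⟨hg, hgm⟩, hgd⟩, l, hl⟩
    exact ⟨⟨⟨add_mem hf hg, fun s x => (hfm s x).add (hgm s x)⟩, hfd.add hgd⟩, max k l,
      (hk.mono (le_max_left _ _)).add (hl.mono (le_max_right _ _))⟩
  algebraMap_mem' := fun c =>
    ⟨⟨⟨algebraMap_mem _ c, fun _ _ => moderateOnHalfPlane_const c⟩, finiteDetermination_const c⟩,
      1, killedBy_one_of_const fun _ _ => rfl⟩

variable [IsManifold 𝓘(ℂ) ω C] [IsManifold 𝓘(ℂ) ω Cbar] [IsManifold 𝓘(ℂ) ω Ct]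

theorem isStableSubalgebra_unipotentNilsson {A : Type*} [CommRing A] [IsDomain A] [Algebra ℂ A]
    [IsNoetherianRing A] (hdim : ringKrullDim A = 1) (an : Analytification A C)
    (L : LiftedDiscs φ U) : IsStableSubalgebra an U (unipotentNilsson L) := by
  refine ⟨fun f hf => hf.1.1.1, ?_⟩
  rintro f ⟨⟨⟨hf, hfm⟩, hfd⟩, k, hk⟩ η z₀ g ⟨hg, -, hdg⟩
  have hprim : IsPrimitive an U f η g := ⟨hg, hdg⟩
  exact ⟨⟨⟨hg, fun s x => hprim.moderateOnHalfPlane L s x hdim (hfm s x)⟩,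
    hprim.finiteDetermination hfd⟩, k + 1, hprim.killedBy hk⟩

end Expansion

end NilssonCurve

end

theorem mainTheorem10
    {A : Type*} [CommRing A] [IsDomain A] [Algebra ℂ A] [Algebra.Smooth ℂ A]
    (hdim : ringKrullDim A = 1)
    {C : Type*} [TopologicalSpace C] [ChartedSpace ℂ C] [IsManifold 𝓘(ℂ) ω C]
    {Cbar : Type*} [TopologicalSpace Cbar] [ChartedSpace ℂ Cbar] [IsManifold 𝓘(ℂ) ω Cbar]
    [CompactSpace Cbar] [T2Space Cbar] [ConnectedSpace Cbar]
    {Ct : Type*} [TopologicalSpace Ct] [ChartedSpace ℂ Ct] [IsManifold 𝓘(ℂ) ω Ct]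
    (an : NilssonCurve.Analytification A C)
    (K : NilssonCurve.Compactification C Cbar)
    (U : NilssonCurve.UniversalCover C Ct)
    (φ : NilssonCurve.PunctureDiscs K)
    (L : NilssonCurve.LiftedDiscs φ U) :
    (∀ f ∈ NilssonCurve.moderateFiltrationTop L, ∀ (s : K.punctures) (x : φ.lifts U s),
      NilssonCurve.IsLogPolynomial (f ∘ L.φt s x) ∧
      NilssonCurve.HasIntegralNilssonExpansion (f ∘ L.φt s x)) ∧
    (∀ f ∈ NilssonCurve.minimalStableSubalgebra an U,
      NilssonCurve.IsNilssonClass L f ∧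
      ∀ (s : K.punctures) (x : φ.lifts U s),
        NilssonCurve.IsLogPolynomial (f ∘ L.φt s x) ∧
        NilssonCurve.HasIntegralNilssonExpansion (f ∘ L.φt s x)) := by
  have : IsNoetherianRing A := Algebra.FiniteType.isNoetherianRing ℂ A
  constructor
  · intro f hf s x
    obtain ⟨n, hf, hn⟩ := Set.mem_iUnion.1 hf
    -- The condition defining the n-th filtration step unfolds to `KilledBy` with index n + 1.
    have h := NilssonCurve.isLogPolynomial_of_killedBy L s x hf hn
    exact ⟨h, h.hasIntegralNilssonExpansion⟩
  · intro f hf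
    obtain ⟨hN, k, hk⟩ : f ∈ NilssonCurve.unipotentNilsson L :=
      (sInf_le (NilssonCurve.isStableSubalgebra_unipotentNilsson hdim an L) :
        NilssonCurve.minimalStableSubalgebra an U ≤ _) hf
    refine ⟨hN, fun s x => ?_⟩
    have h := NilssonCurve.isLogPolynomial_of_killedBy L s x hN.1 hk
    exact ⟨h, h.hasIntegralNilssonExpansion⟩
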